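/- Let $\Phi$ be a homogeneous Poisson point process in $\mathbb{R}^2$ with density $\lambda>0$. For a locally finite set $\phi\subset\mathbb{R}^2$ and two different points $x,y\in\phi$ write $x\to y$ if $y$ is the (unique) nearest point to $x$ in $\phi\setminus\{x\}$, and $x\leftrightarrow y$ if $x\to y$ and $y\to x$. Let $\phi^{(2)}$ be the set of all $x\in\phi$ such that $x\leftrightarrow y$ for some $y\in\phi$, and let $\Phi^{(2)}$ be the point process of paired atoms of $\Phi$ obtained in this way. The Palm measure at $0$ of a stationary point process $\Psi$ with intensity $\mu\in(0,\infty)$ is the probability measure $Q$ on the space of locally finite sets such that $\mathbb{E}\sum_{x\in\Psi}\mathbf 1\{x\in A\}\,\mathbf 1\{\Psi-x\in\Gamma\}=\mu\,|A|\,Q(\Gamma)$ for all Borel sets $A\subset\mathbb{R}^2$, where $|A|$ is the area of $A$, and all events $\Gamma$; the Palm measure at $x$ is the image of $Q$ under translation by $x$. Then $\Phi$ and $\Phi^{(2)}$ are stationary with positive finite intensities, and each has exactly one Palm measure at $0$. Denote that of $\Phi$ by $\mathbb{P}^{0}$ and the Palm measure of $\Phi^{(2)}$ at $x$ by $\mathbb{P}^{(2),x}$.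 The measure $\mathbb{P}^{(2),0}$ is the image under $\phi\mapsto\phi^{(2)}$ of $\mathbb{P}^{0}$ conditioned on the event $\{0\in\phi^{(2)}\}$ that the atom at $0$ is paired. For every $x\in\mathbb{R}^2$ and $r\ge 0$, the nearest-neighbour function of $\Phi^{(2)}$ is $$G^{(2)}(r)=\mathbb{P}^{(2),x}\bigl(d(x,\psi\setminus\{x\})\le r\bigr)=1-e^{-\lambda\pi r^2(2-\gamma)},\qquad \gamma=\frac23-\frac{\sqrt3}{2\pi},$$ where $\psi$ denotes the random point set with law $\mathbb{P}^{(2),x}$. That is, under $\mathbb{P}^{(2),x}$ the nearest-neighbour distance $d(x,\psi\setminus\{x\})$ has the Rayleigh distribution with scale parameter $\sigma=(2\lambda\pi(2-\gamma))^{-1/2}$. -/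

import Mathlib

open MeasureTheory ProbabilityTheory
open scoped ENNReal NNReal

namespace NNPairs

/-- The Euclidean plane. -/
abbrev Plane : Type := EuclideanSpace ℝ (Fin 2)

/-- Realisations of a (simple) planar point process: locally finite sets of atoms. -/
def Config : Type :=
  {s : Set Plane // ∀ B : Set Plane, Bornology.IsBounded B → (s ∩ B).Finite}

namespace Config

/-- The set of atoms of a realisation. -/
def atoms (φ : Config) : Set Plane := φ.1

/-- The number of atoms of `φ` in `B`. -/
noncomputable def count (φ : Config) (B : Set Plane) : ℕ∞ := (φ.atoms ∩ B).encard

/-- The σ-algebra on realisations generated by the numbers of atoms in Borel sets. -/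
noncomputable instance : MeasurableSpace Config :=
  ⨆ (B : Set Plane) (_ : MeasurableSet B),
    MeasurableSpace.comap (fun φ : Config => φ.count B) inferInstance

/-- The realisation `φ` translated by `v`, that is `{x + v | x ∈ φ}`. -/
def translate (v : Plane) (φ : Config) : Config :=
  ⟨(fun x => x + v) '' φ.atoms, by
    intro B hB
    have hB' : Bornology.IsBounded ((fun x : Plane => x - v) '' B) :=
      (LipschitzWith.of_dist_le_mul (K := 1) (fun x y => by simp)).isBounded_image hB
    refine ((φ.2 _ hB').image (fun x => x + v)).subset ?_
    rintro _ ⟨⟨x, hx, rfl⟩, hxB⟩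
    exact ⟨x, ⟨hx, x + v, hxB, by simp⟩, rfl⟩⟩

/-- Nearest neighbour relation `x → y` in `φ`: `x` and `y` are two different atoms and
`y` is the (unique) point at which `z ↦ dist x z` is minimal over `φ \ {x}`. -/
def NNR (φ : Config) (x y : Plane) : Prop :=
  x ∈ φ.atoms ∧ y ∈ φ.atoms ∧ x ≠ y ∧
    ∀ z ∈ φ.atoms, z ≠ x → z ≠ y → dist x y < dist x z

/-- Mutually nearest neighbour relation `x ↔ y` in `φ`. -/
def MNNR (φ : Config) (x y : Plane) : Prop := φ.NNR x y ∧ φ.NNR y x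

/-- The realisation `φ⁽²⁾` of all atoms of `φ` that are in mutually nearest neighbour relation
with another atom of `φ`. -/
def paired (φ : Config) : Config :=
  ⟨{x | x ∈ φ.atoms ∧ ∃ y ∈ φ.atoms, φ.MNNR x y}, fun B hB =>
    (φ.2 B hB).subset (fun _ hx => ⟨hx.1.1, hx.2⟩)⟩

/-- The distance from `x` to the nearest atom of `φ` other than `x`
(infinite if there is no other atom). -/
noncomputable def nnDist (x : Plane) (φ : Config) : ℝ≥0∞ :=
  Metric.infEDist x (φ.atoms \ {x})

end Config

variable {Ω : Type*} [MeasurableSpace Ω]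

/-- `Φ` is a homogeneous Poisson point process in the plane with density `lam`. -/
structure IsPoissonProcess (P : Measure Ω) (Φ : Ω → Config) (lam : ℝ≥0) : Prop where
  measurable : Measurable Φ
  count_law : ∀ B : Set Plane, MeasurableSet B → volume B ≠ ∞ →
    P.map (fun ω => (Φ ω).count B) =
      (poissonMeasure (lam * (volume B).toNNReal)).map (fun n : ℕ => (n : ℕ∞))
  indep : ∀ (n : ℕ) (B : Fin n → Set Plane), (∀ i, MeasurableSet (B i)) →
    Pairwise (fun i j => Disjoint (B i) (B j)) →
    iIndepFun (fun i ω => (Φ ω).count (B i)) P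

/-- `Ψ` is a stationary point process: its law is invariant under all translations. -/
structure IsStationary (P : Measure Ω) (Ψ : Ω → Config) : Prop where
  measurable : Measurable Ψ
  map_translate : ∀ v : Plane, P.map (fun ω => (Ψ ω).translate v) = P.map Ψ

/-- The intensity of a stationary point process: the expected number of atoms in a unit square. -/
noncomputable def intensity (P : Measure Ω) (Ψ : Ω → Config) : ℝ≥0∞ :=
  ∫⁻ ω, ((Ψ ω).count {x : Plane | ∀ i, x i ∈ Set.Ico (0 : ℝ) 1} : ℝ≥0∞) ∂P

/-- `Q` is the Palm probability measure (at the origin) of the stationary point process `Ψ`,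
which has positive and finite intensity:
`E ∑_{x ∈ Ψ} 1{x ∈ A} 1{Ψ - x ∈ Γ} = intensity · area(A) · Q(Γ)` for all `A` and `Γ`. -/
structure IsPalm (P : Measure Ω) (Ψ : Ω → Config) (Q : Measure Config) : Prop where
  stationary : IsStationary P Ψ
  intensity_pos : 0 < intensity P Ψ
  intensity_lt_top : intensity P Ψ < ∞
  isProbabilityMeasure : IsProbabilityMeasure Q
  campbell : ∀ (A : Set Plane) (Γ : Set Config), MeasurableSet A → MeasurableSet Γ →
    ∫⁻ ω, ∑' x : (Ψ ω).atoms, A.indicator 1 (x : Plane) *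
        Γ.indicator 1 ((Ψ ω).translate (-(x : Plane))) ∂P
      = intensity P Ψ * volume A * Q Γ

/-- The Palm probability measure at `x` of a stationary point process
whose Palm probability measure at the origin is `Q`. -/
noncomputable def palmAt (Q : Measure Config) (x : Plane) : Measure Config :=
  Q.map (Config.translate x)

/-- The constant `γ = 2/3 - √3/(2π)`. -/
noncomputable def gammaConst : ℝ := 2 / 3 - √3 / (2 * Real.pi)

/-- The Rayleigh distribution with scale parameter `σ`. -/
noncomputable def rayleighMeasure (σ : ℝ) : Measure ℝ :=
  volume.withDensity (fun r =>
    if 0 ≤ r then ENNReal.ofReal (r / σ ^ 2 * Real.exp (-r ^ 2 / (2 * σ ^ 2))) else 0)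

end NNPairs

open NNPairs

/-! Two atoms `x`, `y` are mutual nearest neighbours exactly when no further atom lies in the union
of the closed discs of radius `dist x y` around them (`mNNR_iff`). A paired atom has exactly one
partner, which is itself paired and hence remains the nearest point after the unpaired atoms are
deleted. So a sum over paired atoms of a function of the nearest-neighbour distance is a sum over
ordered pairs of atoms with an emptiness condition (`indicator_paired_eq_tsum`).

Two applications of the Mecke formula turn its expectation into an integral of `g(|y|)` against `λ²
exp(-λ · area)`, where the two discs have area `π(2 - γ)|y|²`: the lens they share has area
`πγ|y|²`. In polar coordinates the weight becomes a multiple of `ρ exp(-cρ²)` with `c = λπ(2 - γ)`,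
which is the Rayleigh density. Dividing by the intensity gives the law under the Palm measure.

The Mecke formula is proved on the rectangles `A × {no atoms in B}`. There it reduces to
independence of counts in disjoint sets, and it extends because void events form a π-system
generating the σ-algebra.

Palm measures exist because the Campbell measure, with the event fixed, is translation invariant in
the location, hence a multiple of area; the Campbell formula on the unit square determines them.
Pairing commutes with translations, so passing to paired atoms amounts to conditioning the typical
atom on being paired. -/

namespace NNPairs

/-! ### Configurations as counting measures -/

namespace Config

theorem ext_atoms {φ ψ : Config} (h : φ.atoms = ψ.atoms) : φ = ψ := Subtype.ext h

theorem finite_inter (φ : Config) {B : Set Plane} (hB : Bornology.IsBounded B) :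
    (φ.atoms ∩ B).Finite := φ.2 B hB

theorem countable_atoms (φ : Config) : φ.atoms.Countable := by
  have : φ.atoms = ⋃ n : ℕ, φ.atoms ∩ Metric.closedBall 0 n := by
    rw [← Set.inter_iUnion, Metric.iUnion_closedBall_nat, Set.inter_univ]
  rw [this]
  exact Set.countable_iUnion fun n => (φ.finite_inter Metric.isBounded_closedBall).countable

instance (φ : Config) : Countable φ.atoms := φ.countable_atoms.to_subtype

theorem measurable_count {B : Set Plane} (hB : MeasurableSet B) :
    Measurable fun φ : Config => φ.count B := by
  refine Measurable.mono (comap_measurable _) ?_ le_rfl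
  exact le_iSup₂_of_le (f := fun (B : Set Plane) (_ : MeasurableSet B) =>
    MeasurableSpace.comap (fun φ : Config => φ.count B) inferInstance) B hB le_rfl

theorem measurable_of_count {α : Type*} [MeasurableSpace α] {F : α → Config}
    (h : ∀ B, MeasurableSet B → Measurable fun a => (F a).count B) : Measurable F := by
  rw [measurable_iff_comap_le]
  simp only [instMeasurableSpace, MeasurableSpace.comap_iSup, MeasurableSpace.comap_comp]
  exact iSup₂_le fun B hB => (h B hB).comap_le

/-- The counting measure on the atoms of a realisation. -/
noncomputable def points (φ : Config) : Measure Plane :=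
  Measure.sum fun x : φ.atoms => Measure.dirac (x : Plane)

theorem lintegral_points (φ : Config) (f : Plane → ℝ≥0∞) :
    ∫⁻ x, f x ∂φ.points = ∑' x : φ.atoms, f x := by
  simp [points, lintegral_sum_measure]

theorem cast_count (φ : Config) (B : Set Plane) :
    (φ.count B : ℝ≥0∞) = ∑' x : φ.atoms, (B.indicator 1 (x : Plane) : ℝ≥0∞) := by
  rw [count, ← ENNReal.tsum_set_one,
    tsum_subtype (φ.atoms ∩ B) (fun _ => (1 : ℝ≥0∞)), tsum_subtype φ.atoms (B.indicator 1)]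
  congr 1
  ext x
  by_cases h1 : x ∈ φ.atoms <;> by_cases h2 : x ∈ B <;> simp [h1, h2]

theorem points_apply (φ : Config) {B : Set Plane} (hB : MeasurableSet B) :
    φ.points B = (φ.count B : ℝ≥0∞) := by
  rw [← lintegral_indicator_one hB, lintegral_points, cast_count]

theorem measurable_points : Measurable points := by
  refine Measure.measurable_of_measurable_coe _ fun B hB => ?_
  simp_rw [points_apply _ hB]
  exact (Measurable.of_discrete (f := fun n : ℕ∞ => (n : ℝ≥0∞))).comp (measurable_count hB)

/-- The counting measures of realisations as a kernel. -/
noncomputable def pointsKernel : Kernel Config Plane := ⟨points, measurable_points⟩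

theorem pointsKernel_apply (φ : Config) : pointsKernel φ = φ.points := rfl

theorem measurable_measurableSet_count {B : Set Plane} (hB : MeasurableSet B) (k : ℕ) :
    MeasurableSet {φ : Config | φ.count B = k} :=
  measurable_count hB (.of_discrete (s := {(k : ℕ∞)}))

/-- The annuli `{n - 1 < ‖x‖ ≤ n}`, a partition of the plane into bounded sets. -/
noncomputable def layer (n : ℕ) : Set Plane :=
  disjointed (fun n : ℕ => Metric.closedBall (0 : Plane) n) n

theorem measurableSet_layer (n : ℕ) : MeasurableSet (layer n) :=
  MeasurableSet.disjointed (fun _ => Metric.isClosed_closedBall.measurableSet) n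

theorem iUnion_layer : ⋃ n, layer n = Set.univ := by
  unfold layer
  rw [iUnion_disjointed, Metric.iUnion_closedBall_nat]

/-- The mass in a bounded set is finite but not uniformly bounded over configurations. Splitting by
annulus and by the number `k` of atoms in it gives countably many kernels, each of mass at most `k`.
S-finiteness is what permits Fubini-type arguments with sums over atoms. -/
instance : IsSFiniteKernel pointsKernel := by
  classical
  have key : pointsKernel = Kernel.sum fun p : ℕ × ℕ =>
      Kernel.piecewise (measurable_measurableSet_count (measurableSet_layer p.1) p.2)
        (pointsKernel.restrict (measurableSet_layer p.1)) 0 := by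
    ext φ B hB
    rw [Kernel.sum_apply' _ _ hB, ENNReal.tsum_prod' (f := fun p : ℕ × ℕ => (Kernel.piecewise
      (measurable_measurableSet_count (measurableSet_layer p.1) p.2)
        (pointsKernel.restrict (measurableSet_layer p.1)) 0) φ B)]
    have h1 : ∀ n, ∑' k : ℕ, (Kernel.piecewise
        (measurable_measurableSet_count (measurableSet_layer n) k)
        (pointsKernel.restrict (measurableSet_layer n)) 0) φ B = φ.points (B ∩ layer n) := by
      intro n
      have hfin : φ.count (layer n) ≠ ⊤ := by
        rw [count, Set.encard_ne_top_iff]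
        exact φ.finite_inter (Metric.isBounded_closedBall.subset (disjointed_subset _ n))
      obtain ⟨m, hm⟩ := ENat.ne_top_iff_exists.1 hfin
      rw [tsum_eq_single m]
      · rw [Kernel.piecewise_apply', if_pos (show φ ∈ {φ : Config | φ.count (layer n) = m} from hm.symm), Kernel.restrict_apply' _ _ _ hB]
        rfl
      · intro k hk
        rw [Kernel.piecewise_apply', if_neg]
        · simp
        · intro h
          have h' : φ.count (layer n) = k := h
          rw [← hm] at h'
          exact hk (by exact_mod_cast h'.symm)
    simp_rw [h1]
    rw [← measure_iUnion, ← Set.inter_iUnion, iUnion_layer, Set.inter_univ]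
    · rfl
    · intro i j hij
      exact ((disjoint_disjointed _ hij).mono Set.inter_subset_right Set.inter_subset_right)
    · exact fun n => hB.inter (measurableSet_layer n)
  rw [key]
  have : ∀ p : ℕ × ℕ, IsSFiniteKernel (Kernel.piecewise
      (measurable_measurableSet_count (measurableSet_layer p.1) p.2)
        (pointsKernel.restrict (measurableSet_layer p.1)) 0) := by
    intro p
    have : IsFiniteKernel (Kernel.piecewise
      (measurable_measurableSet_count (measurableSet_layer p.1) p.2)
        (pointsKernel.restrict (measurableSet_layer p.1)) 0) := by
      refine ⟨⟨p.2, by simp, fun φ => ?_⟩⟩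
      rw [Kernel.piecewise_apply']
      split_ifs with h
      · rw [Kernel.restrict_apply' _ _ _ MeasurableSet.univ, Set.univ_inter, pointsKernel_apply,
          points_apply _ (measurableSet_layer _), show φ.count (layer p.1) = p.2 from h]
        simp
      · simp
    infer_instance
  exact Kernel.isSFiniteKernel_sum (hκs := this)

/-! ### Measurability of operations on atoms -/

section Measurability

variable {α : Type*} [MeasurableSpace α]

/-- The sum is an integral against an s-finite kernel, so joint measurability of `f` suffices. All
other measurability statements about atoms reduce to this one; existence of an atom, for instance,
says that a sum of indicators is nonzero. -/
theorem measurable_tsum_atoms {F : α → Config} (hF : Measurable F) {f : α → Plane → ℝ≥0∞}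
    (hf : Measurable (Function.uncurry f)) :
    Measurable fun a => ∑' x : (F a).atoms, f a x := by
  have := Measurable.lintegral_kernel_prod_right' (κ := pointsKernel.comap F hF)
    (f := Function.uncurry f) hf
  simpa [Kernel.comap_apply, pointsKernel_apply, lintegral_points] using this

theorem measurableSet_exists_atom {F : α → Config} (hF : Measurable F) {p : α → Plane → Prop}
    (hp : MeasurableSet {q : α × Plane | p q.1 q.2}) :
    MeasurableSet {a | ∃ x ∈ (F a).atoms, p a x} := by
  classical
  have h := measurable_tsum_atoms hF
    (f := fun a x => ({q : α × Plane | p q.1 q.2}.indicator 1 (a, x) : ℝ≥0∞))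
    (measurable_one.indicator hp)
  have h2 : {a | ∃ x ∈ (F a).atoms, p a x} = {a | ∑' x : (F a).atoms,
      ({q : α × Plane | p q.1 q.2}.indicator 1 (a, (x : Plane)) : ℝ≥0∞) = 0}ᶜ := by
    ext a
    simp [ENNReal.tsum_eq_zero]
  rw [h2]
  exact (measurableSet_eq_fun h measurable_const).compl

theorem measurableSet_forall_atom {F : α → Config} (hF : Measurable F) {p : α → Plane → Prop}
    (hp : MeasurableSet {q : α × Plane | p q.1 q.2}) :
    MeasurableSet {a | ∀ x ∈ (F a).atoms, p a x} := by
  have h := (measurableSet_exists_atom hF (p := fun a x => ¬ p a x) hp.compl).compl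
  convert h using 1
  ext a
  simp

theorem measurableSet_mem_atoms {F : α → Config} (hF : Measurable F) {g : α → Plane}
    (hg : Measurable g) : MeasurableSet {a | g a ∈ (F a).atoms} := by
  have h := measurableSet_exists_atom hF (p := fun a x => x = g a)
    (measurableSet_eq_fun measurable_snd (hg.comp measurable_fst))
  simpa using h

theorem measurable_of_cast {f : α → ℕ∞} (h : Measurable fun a => (f a : ℝ≥0∞)) :
    Measurable f := by
  refine measurable_to_countable' fun n => ?_
  have : f ⁻¹' {n} = (fun a => (f a : ℝ≥0∞)) ⁻¹' {(n : ℝ≥0∞)} := by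
    ext a
    simp
  rw [this]
  exact h (measurableSet_singleton _)

/-- Injectivity of `g a` makes the count of `G a` in `B` a sum over the atoms of `F a`, each
selected atom contributing once. Translation, deletion of a point and pairing are all of this form.
-/
theorem measurable_of_mem_iff {F G : α → Config} (hF : Measurable F) {g : α → Plane → Plane}
    (hg : Measurable (Function.uncurry g)) (hinj : ∀ a, Function.Injective (g a))
    {p : α → Plane → Prop} (hp : MeasurableSet {q : α × Plane | p q.1 q.2})
    (hG : ∀ a, (G a).atoms = g a '' {x | x ∈ (F a).atoms ∧ p a x}) : Measurable G := by
  refine measurable_of_count fun B hB => measurable_of_cast ?_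
  have h := measurable_tsum_atoms hF
    (f := fun a x => ({q : α × Plane | p q.1 q.2 ∧ g q.1 q.2 ∈ B}.indicator 1 (a, x) : ℝ≥0∞))
    (measurable_one.indicator (hp.inter (hg hB)))
  convert h using 2 with a
  have e : (G a).atoms ∩ B = g a '' {x | x ∈ (F a).atoms ∧ p a x ∧ g a x ∈ B} := by
    rw [hG]
    ext y
    constructor
    · rintro ⟨⟨x, hx, rfl⟩, hB⟩
      exact ⟨x, ⟨hx.1, hx.2, hB⟩, rfl⟩
    · rintro ⟨x, hx, rfl⟩
      exact ⟨⟨x, ⟨hx.1, hx.2.1⟩, rfl⟩, hx.2.2⟩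
  rw [count, e, (hinj a).encard_image, ← ENNReal.tsum_set_one,
    tsum_subtype _ (fun _ => (1 : ℝ≥0∞)), tsum_subtype (F a).atoms
    (fun x => ({q : α × Plane | p q.1 q.2 ∧ g q.1 q.2 ∈ B}.indicator 1 (a, x) : ℝ≥0∞))]
  congr 1
  ext x
  by_cases h1 : x ∈ (F a).atoms <;> by_cases h2 : p a x <;> by_cases h3 : g a x ∈ B <;>
    simp [h1, h2, h3]

theorem measurable_translate {F : α → Config} (hF : Measurable F) {v : α → Plane}
    (hv : Measurable v) : Measurable fun a => (F a).translate (v a) :=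
  measurable_of_mem_iff hF (g := fun a x => x + v a) (p := fun _ _ => True)
    (measurable_snd.add (hv.comp measurable_fst)) (fun _ => add_left_injective _)
    (by simp) (fun a => by simp [translate, atoms])

/-- The realisation `φ` without the atom `x`. -/
def erase (φ : Config) (x : Plane) : Config :=
  ⟨φ.atoms \ {x}, fun B hB => (φ.2 B hB).subset fun _ hy => ⟨hy.1.1, hy.2⟩⟩

theorem atoms_erase (φ : Config) (x : Plane) : (φ.erase x).atoms = φ.atoms \ {x} := rfl

theorem measurable_erase {F : α → Config} (hF : Measurable F) {v : α → Plane}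
    (hv : Measurable v) : Measurable fun a => (F a).erase (v a) :=
  measurable_of_mem_iff hF (g := fun _ x => x) (p := fun a x => x ≠ v a)
    measurable_snd (fun _ => Function.injective_id)
    (measurableSet_eq_fun measurable_snd (hv.comp measurable_fst)).compl
    (fun a => by ext; simp [atoms_erase])

theorem measurableSet_NNR {F : α → Config} (hF : Measurable F) {u v : α → Plane}
    (hu : Measurable u) (hv : Measurable v) : MeasurableSet {a | (F a).NNR (u a) (v a)} := by
  refine (measurableSet_mem_atoms hF hu).inter ((measurableSet_mem_atoms hF hv).inter
    ((measurableSet_eq_fun hu hv).compl.inter (measurableSet_forall_atom hF ?_)))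
  have hu' := hu.comp (measurable_fst : Measurable (Prod.fst : α × Plane → α))
  have hv' := hv.comp (measurable_fst : Measurable (Prod.fst : α × Plane → α))
  have h1 := measurableSet_eq_fun (measurable_snd : Measurable (Prod.snd : α × Plane → Plane)) hu'
  have h2 := measurableSet_eq_fun (measurable_snd : Measurable (Prod.snd : α × Plane → Plane)) hv'
  have h3 := measurableSet_lt (hu'.dist hv') (hu'.dist measurable_snd)
  convert (h1.union (h2.union h3)) using 1
  ext q
  simp only [Set.mem_ofPred_eq, Set.mem_union, Function.comp]
  tauto

theorem measurableSet_MNNR {F : α → Config} (hF : Measurable F) {u v : α → Plane}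
    (hu : Measurable u) (hv : Measurable v) : MeasurableSet {a | (F a).MNNR (u a) (v a)} :=
  (measurableSet_NNR hF hu hv).inter (measurableSet_NNR hF hv hu)

theorem atoms_paired (φ : Config) :
    φ.paired.atoms = {x | x ∈ φ.atoms ∧ ∃ y ∈ φ.atoms, φ.MNNR x y} := rfl

theorem measurable_paired : Measurable paired :=
  measurable_of_mem_iff measurable_id (g := fun _ x => x)
    (p := fun φ x => ∃ y ∈ φ.atoms, φ.MNNR x y)
    measurable_snd (fun _ => Function.injective_id)
    (measurableSet_exists_atom (F := fun q : Config × Plane => q.1) measurable_fst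
      (measurableSet_MNNR (F := fun q : (Config × Plane) × Plane => q.1.1)
        (measurable_fst.comp measurable_fst) (measurable_snd.comp measurable_fst) measurable_snd))
    (fun a => by simp [atoms_paired])

theorem measurable_nnDist (x : Plane) : Measurable (nnDist x) := by
  refine measurable_of_Iio fun r => ?_
  have h := measurableSet_exists_atom (F := fun φ : Config => φ) measurable_id
    (p := fun _ y => y ≠ x ∧ edist x y < r)
    ((measurableSet_eq_fun measurable_snd measurable_const).compl.inter
      (measurableSet_lt (measurable_const.edist measurable_snd) measurable_const))
  convert h using 1
  ext φ
  simp only [Set.mem_preimage, Set.mem_Iio, nnDist, Metric.infEDist_lt_iff, Set.mem_ofPred_eq,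
    Set.mem_sdiff, Set.mem_singleton_iff, and_assoc]

end Measurability

end Config

end NNPairs

/-! ### Void events generate the σ-algebra -/

namespace NNPairs

namespace Config

/-- The event that a realisation has no atoms in `B`. -/
def void (B : Set Plane) : Set Config := {φ | φ.atoms ∩ B = ∅}

theorem mem_void {φ : Config} {B : Set Plane} : φ ∈ void B ↔ φ.atoms ∩ B = ∅ := Iff.rfl

theorem mem_void_iff {φ : Config} {B : Set Plane} : φ ∈ void B ↔ φ.count B = 0 := by
  rw [count, Set.encard_eq_zero, mem_void]

theorem measurableSet_void {B : Set Plane} (hB : MeasurableSet B) : MeasurableSet (void B) := by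
  have := measurable_measurableSet_count hB 0
  convert this using 1
  ext φ
  simp [mem_void_iff]

/-- The void events of Borel sets of finite area. -/
def voids : Set (Set Config) := {V | ∃ B, MeasurableSet B ∧ volume B ≠ ∞ ∧ void B = V}

theorem void_inter_void (B C : Set Plane) : void B ∩ void C = void (B ∪ C) := by
  ext φ
  simp only [Set.mem_inter_iff, mem_void, Set.inter_union_distrib_left, Set.union_empty_iff]

theorem isPiSystem_voids : IsPiSystem voids := by
  rintro _ ⟨B, hB, hB', rfl⟩ _ ⟨C, hC, hC', rfl⟩ -
  exact ⟨B ∪ C, hB.union hC, (measure_union_lt_top hB'.lt_top hC'.lt_top).ne,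
    (void_inter_void B C).symm⟩

theorem void_empty : void ∅ = Set.univ := by
  ext φ
  simp [mem_void]

theorem univ_mem_voids : Set.univ ∈ voids := ⟨∅, MeasurableSet.empty, by simp, void_empty⟩

theorem void_iUnion {ι : Sort*} (B : ι → Set Plane) : void (⋃ i, B i) = ⋂ i, void (B i) := by
  ext φ
  simp [mem_void, Set.inter_iUnion, Set.iUnion_eq_empty]

/-- Finitely many points can be separated by disjoint basic open sets. With a countable basis this
writes the event of at least `k` atoms as a countable union of finite intersections of complements
of void events. -/
theorem natCast_le_count_iff {b : Set (Set Plane)} (hb : TopologicalSpace.IsTopologicalBasis b)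
    (φ : Config) (B : Set Plane) (k : ℕ) :
    (k : ℕ∞) ≤ φ.count B ↔ ∃ u : Fin k → b,
      Pairwise (fun i j => Disjoint (u i : Set Plane) (u j)) ∧ ∀ i, φ ∉ void (B ∩ u i) := by
  constructor
  · intro h
    obtain ⟨t, ht, htk⟩ := Set.exists_subset_encard_eq h
    have htf : t.Finite := Set.finite_of_encard_eq_coe htk
    obtain ⟨U, hU, hd⟩ := htf.t2_separation
    have hx : ∀ x : Plane, ∃ v ∈ b, x ∈ v ∧ v ⊆ U x := fun x =>
      hb.exists_subset_of_mem_open (hU x).1 (hU x).2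
    choose v hvb hxv hvU using hx
    have hcard : t.ncard = k := by rw [Set.ncard, htk]; rfl
    have : Finite t := htf
    let e : Fin k ≃ t := (Finite.equivFinOfCardEq hcard).symm
    refine ⟨fun i => ⟨v (e i), hvb _⟩, fun i j hij => ?_, fun i => ?_⟩
    · exact (hd (e i).2 (e j).2 fun h => hij (e.injective (Subtype.ext h))).mono (hvU _) (hvU _)
    · rw [mem_void, ← ne_eq, ← Set.nonempty_iff_ne_empty]
      exact ⟨e i, (ht (e i).2).1, (ht (e i).2).2, hxv _⟩
  · rintro ⟨u, hd, hu⟩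
    have : ∀ i, ∃ x, x ∈ φ.atoms ∩ (B ∩ u i) := fun i => Set.nonempty_iff_ne_empty.2 (hu i)
    choose x hx using this
    have hinj : Function.Injective x := by
      intro i j hij
      by_contra hne
      exact Set.disjoint_left.1 (hd hne) (hx i).2.2 (hij ▸ (hx j).2.2)
    have h1 : (Set.range x).encard = k := by
      rw [← Set.image_univ, hinj.encard_image, Set.encard_univ]
      simp
    rw [← h1]
    refine Set.encard_le_encard ?_
    rintro _ ⟨i, rfl⟩
    exact ⟨(hx i).1, (hx i).2.1⟩

theorem generateFrom_voids :
    MeasurableSpace.generateFrom voids = (inferInstance : MeasurableSpace Config) := by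
  apply le_antisymm
  · refine MeasurableSpace.generateFrom_le ?_
    rintro _ ⟨B, hB, -, rfl⟩
    exact measurableSet_void hB
  · have hvoid : ∀ B, MeasurableSet B → MeasurableSet[MeasurableSpace.generateFrom voids]
        (void B) := by
      intro B hB
      have : B = ⋃ n : ℕ, B ∩ Metric.closedBall 0 n := by
        rw [← Set.inter_iUnion, Metric.iUnion_closedBall_nat, Set.inter_univ]
      rw [this, void_iUnion]
      refine MeasurableSet.iInter fun n => MeasurableSpace.measurableSet_generateFrom
        ⟨_, hB.inter Metric.isClosed_closedBall.measurableSet, ?_, rfl⟩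
      exact ((measure_mono Set.inter_subset_right).trans_lt measure_closedBall_lt_top).ne
    have hle : ∀ B, MeasurableSet B → ∀ k : ℕ,
        MeasurableSet[MeasurableSpace.generateFrom voids] {φ : Config | (k : ℕ∞) ≤ φ.count B} := by
      intro B hB k
      let b := TopologicalSpace.countableBasis Plane
      have hb := TopologicalSpace.isBasis_countableBasis Plane
      have : Countable b := (TopologicalSpace.countable_countableBasis Plane).to_subtype
      have e : {φ : Config | (k : ℕ∞) ≤ φ.count B} = ⋃ u : Fin k → b,
          ⋃ _ : Pairwise (fun i j => Disjoint (u i : Set Plane) (u j)),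
            ⋂ i, (void (B ∩ u i))ᶜ := by
        ext φ
        simp only [Set.mem_ofPred_eq, natCast_le_count_iff hb, Set.mem_iUnion, Set.mem_iInter,
          Set.mem_compl_iff, exists_prop, b]
      rw [e]
      refine MeasurableSet.iUnion fun u => MeasurableSet.iUnion fun _ => MeasurableSet.iInter
        fun i => (hvoid _ (hB.inter ?_)).compl
      exact (hb.isOpen (u i).2).measurableSet
    refine iSup₂_le fun B hB => ?_
    rw [← measurable_iff_comap_le]
    have hn : ∀ k : ℕ, MeasurableSet[MeasurableSpace.generateFrom voids]
        ((fun φ : Config => φ.count B) ⁻¹' {(k : ℕ∞)}) := by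
      intro k
      have e : (fun φ : Config => φ.count B) ⁻¹' {(k : ℕ∞)} =
          {φ : Config | (k : ℕ∞) ≤ φ.count B} \ {φ : Config | ((k + 1 : ℕ) : ℕ∞) ≤ φ.count B} := by
        ext φ
        simp only [Set.mem_preimage, Set.mem_singleton_iff, Set.mem_sdiff, Set.mem_ofPred_eq,
          not_le, Nat.cast_add, Nat.cast_one]
        rw [ENat.lt_add_one_iff (by simp)]
        exact ⟨fun h => ⟨h.ge, h.le⟩, fun h => le_antisymm h.2 h.1⟩
      rw [e]
      exact (hle B hB k).diff (hle B hB (k + 1))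
    refine @measurable_to_countable' _ _ _ _ (MeasurableSpace.generateFrom voids) _ fun n => ?_
    induction n using ENat.recTopCoe with
    | coe k => exact hn k
    | top =>
      have e : (fun φ : Config => φ.count B) ⁻¹' {⊤} =
          (⋃ k : ℕ, (fun φ : Config => φ.count B) ⁻¹' {(k : ℕ∞)})ᶜ := by
        ext φ
        simp only [Set.mem_preimage, Set.mem_singleton_iff, Set.mem_compl_iff, Set.mem_iUnion]
        rw [← not_iff_not, not_not, ← ne_eq, ENat.ne_top_iff_exists]
        exact exists_congr fun _ => eq_comm
      rw [e]
      exact (MeasurableSet.iUnion hn).compl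

/-- Two probability measures on realisations with the same void probabilities agree. -/
theorem ext_of_void {μ ν : Measure Config} [IsProbabilityMeasure μ] [IsProbabilityMeasure ν]
    (h : ∀ B, MeasurableSet B → volume B ≠ ∞ → μ (void B) = ν (void B)) : μ = ν := by
  refine ext_of_generate_finite voids generateFrom_voids.symm isPiSystem_voids ?_ (by simp)
  rintro _ ⟨B, hB, hB', rfl⟩
  exact h B hB hB'

end Config

end NNPairs

/-! ### Equivariance under translations -/

namespace NNPairs

namespace Config

theorem translate_translate (φ : Config) (v w : Plane) :
    (φ.translate v).translate w = φ.translate (v + w) := by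
  apply ext_atoms
  simp only [translate, atoms, Set.image_image, add_assoc]

theorem mem_atoms_translate {φ : Config} {v x : Plane} :
    x ∈ (φ.translate v).atoms ↔ x - v ∈ φ.atoms := by
  constructor
  · rintro ⟨y, hy, rfl⟩
    simpa [atoms] using hy
  · intro h
    exact ⟨x - v, h, by simp⟩

theorem tsum_atoms_translate (φ : Config) (v : Plane) (f : Plane → ℝ≥0∞) :
    ∑' x : (φ.translate v).atoms, f x = ∑' x : φ.atoms, f (x + v) := by
  have e : (φ.translate v).atoms = (fun x => x + v) '' φ.atoms := rfl
  rw [e]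
  exact tsum_image f ((add_left_injective v).injOn)

theorem NNR_translate {φ : Config} {v x y : Plane} :
    (φ.translate v).NNR x y ↔ φ.NNR (x - v) (y - v) := by
  unfold NNR
  simp only [mem_atoms_translate]
  refine and_congr_right fun _ => and_congr_right fun _ => and_congr (by simp) ?_
  rw [← (Equiv.subRight v).forall_congr_right (q := fun z => z ∈ φ.atoms → z ≠ x - v → z ≠ y - v →
    dist (x - v) (y - v) < dist (x - v) z)]
  simp [Equiv.subRight]

theorem paired_translate (φ : Config) (v : Plane) :
    (φ.translate v).paired = φ.paired.translate v := by
  apply ext_atoms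
  ext x
  simp only [mem_atoms_translate, atoms_paired, Set.mem_ofPred_eq, MNNR, NNR_translate]
  refine and_congr_right fun _ => ?_
  rw [← (Equiv.subRight v).exists_congr_right (q := fun y => y ∈ φ.atoms ∧
    φ.NNR (x - v) y ∧ φ.NNR y (x - v))]
  simp [Equiv.subRight]

theorem nnDist_translate (φ : Config) (v x : Plane) :
    (φ.translate v).nnDist x = φ.nnDist (x - v) := by
  have e : (φ.translate v).atoms \ {x} = (fun y => y + v) '' (φ.atoms \ {x - v}) := by
    rw [Set.image_sdiff (add_left_injective v), Set.image_singleton, sub_add_cancel]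
    rfl
  have h := Metric.infEDist_image (isometry_add_right v) (x := x - v) (t := φ.atoms \ {x - v})
  rw [nnDist, nnDist, e, ← h, sub_add_cancel]

end Config

/-! ### Stationarity and Palm measures -/

open Config

/-- The half-open unit square. -/
def unitSquare : Set Plane := {x | ∀ i, x i ∈ Set.Ico (0 : ℝ) 1}

theorem unitSquare_eq : unitSquare = (WithLp.ofLp : Plane → Fin 2 → ℝ) ⁻¹'
    (Set.univ.pi fun _ => Set.Ico (0 : ℝ) 1) := by
  ext x
  simp [unitSquare]

theorem measurableSet_unitSquare : MeasurableSet unitSquare := by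
  rw [unitSquare_eq]
  exact (PiLp.volume_preserving_ofLp (Fin 2)).measurable
    (MeasurableSet.univ_pi fun _ => measurableSet_Ico)

theorem volume_unitSquare : volume unitSquare = 1 := by
  rw [unitSquare_eq, (PiLp.volume_preserving_ofLp (Fin 2)).measure_preimage
    (MeasurableSet.univ_pi fun _ => measurableSet_Ico).nullMeasurableSet, Real.volume_pi_Ico]
  simp

theorem interior_unitSquare_nonempty : (interior unitSquare).Nonempty := by
  refine ⟨WithLp.toLp 2 fun _ => 1 / 2, mem_interior.2 ⟨{x | ∀ i, x i ∈ Set.Ioo (0 : ℝ) 1},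
    fun x hx i => Set.Ioo_subset_Ico_self (hx i), ?_, fun i => by norm_num⟩⟩
  have : {x : Plane | ∀ i, x i ∈ Set.Ioo (0 : ℝ) 1} = ⋂ i, (fun x : Plane => x i) ⁻¹' Set.Ioo 0 1 := by
    ext x
    simp
  rw [this]
  exact isOpen_iInter_of_finite fun i => isOpen_Ioo.preimage (by fun_prop)

variable {Ω : Type*} [MeasurableSpace Ω] {P : Measure Ω} {Ψ : Ω → Config}

theorem intensity_eq (P : Measure Ω) (Ψ : Ω → Config) :
    intensity P Ψ = ∫⁻ ω, ∑' x : (Ψ ω).atoms, unitSquare.indicator 1 (x : Plane) ∂P := by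
  simp_rw [← cast_count]
  rfl

theorem measurable_campbell_integrand (hΨ : Measurable Ψ) {A : Set Plane} {Γ : Set Config}
    (hA : MeasurableSet A) (hΓ : MeasurableSet Γ) :
    Measurable fun ω => ∑' x : (Ψ ω).atoms, (A.indicator 1 (x : Plane) *
        Γ.indicator 1 ((Ψ ω).translate (-(x : Plane))) : ℝ≥0∞) :=
  measurable_tsum_atoms hΨ (f := fun ω x => A.indicator 1 x * Γ.indicator 1 ((Ψ ω).translate (-x)))
    (((measurable_one.indicator hA).comp measurable_snd).mul ((measurable_one.indicator hΓ).comp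
      (measurable_translate (hΨ.comp measurable_fst) measurable_snd.neg)))

theorem lintegral_map_compProd_pointsKernel [IsProbabilityMeasure P] (hΨ : Measurable Ψ)
    {f : Config × Plane → ℝ≥0∞} (hf : Measurable f) :
    ∫⁻ q, f q ∂(P.map Ψ ⊗ₘ pointsKernel) = ∫⁻ ω, ∑' x : (Ψ ω).atoms, f (Ψ ω, x) ∂P := by
  have := Measure.isProbabilityMeasure_map hΨ.aemeasurable (μ := P)
  have h : Measurable fun φ : Config => ∑' x : φ.atoms, f (φ, x) :=
    measurable_tsum_atoms measurable_id (f := fun φ x => f (φ, x)) hf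
  rw [Measure.lintegral_compProd hf, ← lintegral_map h hΨ]
  simp_rw [pointsKernel_apply, lintegral_points]

/-- The Campbell measure of `Ψ`: the image of the atoms of `Ψ`, together with `Ψ` as seen from
these atoms. -/
noncomputable def campbellMeasure (P : Measure Ω) (Ψ : Ω → Config) : Measure (Plane × Config) :=
  (P.map Ψ ⊗ₘ pointsKernel).map fun q => (q.2, q.1.translate (-q.2))

theorem campbellMeasure_prod [IsProbabilityMeasure P] (hΨ : Measurable Ψ) {A : Set Plane}
    {Γ : Set Config} (hA : MeasurableSet A) (hΓ : MeasurableSet Γ) :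
    campbellMeasure P Ψ (A ×ˢ Γ) = ∫⁻ ω, ∑' x : (Ψ ω).atoms, A.indicator 1 (x : Plane) *
        Γ.indicator 1 ((Ψ ω).translate (-(x : Plane))) ∂P := by
  have hm : Measurable fun q : Config × Plane => (q.2, q.1.translate (-q.2)) :=
    measurable_snd.prodMk (measurable_translate measurable_fst measurable_snd.neg)
  have hi : Measurable ((A ×ˢ Γ).indicator (1 : Plane × Config → ℝ≥0∞)) :=
    measurable_one.indicator (hA.prod hΓ)
  rw [← lintegral_indicator_one (hA.prod hΓ), campbellMeasure, lintegral_map hi hm,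
    lintegral_map_compProd_pointsKernel hΨ
      (f := fun q => (A ×ˢ Γ).indicator 1 (q.2, q.1.translate (-q.2))) (hi.comp hm)]
  simp only [Set.indicator_prod_one]

theorem campbellMeasure_unitSquare [IsProbabilityMeasure P] (hΨ : Measurable Ψ) :
    campbellMeasure P Ψ (unitSquare ×ˢ Set.univ) = intensity P Ψ := by
  rw [campbellMeasure_prod hΨ measurableSet_unitSquare MeasurableSet.univ, intensity_eq]
  simp

/-- Translating the whole process by `v` moves each atom by `v` but leaves the configuration seen
from that atom unchanged, and by stationarity the law does not change. -/
theorem campbellMeasure_prod_add [IsProbabilityMeasure P] (hΨ : IsStationary P Ψ) {A : Set Plane}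
    {Γ : Set Config} (hA : MeasurableSet A) (hΓ : MeasurableSet Γ) (v : Plane) :
    campbellMeasure P Ψ (((fun x => v + x) ⁻¹' A) ×ˢ Γ) = campbellMeasure P Ψ (A ×ˢ Γ) := by
  have hv : Measurable fun ω => (Ψ ω).translate v :=
    measurable_translate hΨ.measurable measurable_const
  have h := measurable_campbell_integrand (Ψ := fun φ : Config => φ) measurable_id hA hΓ
  rw [campbellMeasure_prod hΨ.measurable (measurable_const_add v hA) hΓ,
    campbellMeasure_prod hΨ.measurable hA hΓ, ← lintegral_map h hΨ.measurable,
    ← hΨ.map_translate v, lintegral_map h hv]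
  refine lintegral_congr fun ω => ?_
  rw [tsum_atoms_translate (Ψ ω) v (fun x => A.indicator 1 x *
    Γ.indicator 1 (((Ψ ω).translate v).translate (-x)))]
  refine tsum_congr fun x => ?_
  rw [translate_translate, neg_add_rev, add_neg_cancel_left, add_comm (x : Plane) v]
  rfl

/-- A stationary point process of finite intensity satisfies the Campbell formula up to a constant
depending on the event. -/
theorem campbellMeasure_prod_eq [IsProbabilityMeasure P] (hΨ : IsStationary P Ψ)
    (hfin : intensity P Ψ < ∞) {A : Set Plane}
    {Γ : Set Config} (hA : MeasurableSet A) (hΓ : MeasurableSet Γ) :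
    campbellMeasure P Ψ (A ×ˢ Γ) = campbellMeasure P Ψ (unitSquare ×ˢ Γ) * volume A := by
  -- With `Γ` fixed, the location marginal is a translation-invariant measure. Finiteness on the
  -- unit square, which has nonempty interior, makes it finite on compact sets, so uniqueness of
  -- Haar measure applies.
  let ν : Measure Plane := ((campbellMeasure P Ψ).restrict (Set.univ ×ˢ Γ)).map Prod.fst
  have hν : ∀ B, MeasurableSet B → ν B = campbellMeasure P Ψ (B ×ˢ Γ) := by
    intro B hB
    rw [Measure.map_apply measurable_fst hB, Measure.restrict_apply (measurable_fst hB)]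
    congr 1
    ext q
    simp
  have hinv : ν.IsAddLeftInvariant := by
    refine ⟨fun v => Measure.ext fun B hB => ?_⟩
    rw [Measure.map_apply (measurable_const_add v) hB, hν _ (measurable_const_add v hB), hν _ hB,
      campbellMeasure_prod_add hΨ hB hΓ]
  have hsq : ν unitSquare ≠ ∞ := by
    rw [hν _ measurableSet_unitSquare]
    refine ((measure_mono ?_).trans_lt ((campbellMeasure_unitSquare (P := P) hΨ.measurable).trans_lt hfin)).ne
    exact Set.prod_mono_right (Set.subset_univ _)
  have hK : IsFiniteMeasureOnCompacts ν :=
    ⟨fun K hK => measure_lt_top_of_isCompact_of_isAddLeftInvariant' interior_unitSquare_nonempty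
      hsq hK⟩
  have h := Measure.isAddLeftInvariant_eq_smul ν volume
  have h1 : ν unitSquare = ν.addHaarScalarFactor volume := by
    conv_lhs => rw [h]
    simp [volume_unitSquare]
  rw [← hν _ hA, ← hν _ measurableSet_unitSquare, h1]
  conv_lhs => rw [h]
  simp

/-- A stationary point process with positive and finite intensity has a Palm measure. -/
theorem exists_isPalm [IsProbabilityMeasure P] (hΨ : IsStationary P Ψ) (hpos : 0 < intensity P Ψ)
    (hfin : intensity P Ψ < ∞) : ∃ Q, IsPalm P Ψ Q := by
  let ν : Measure Config := ((campbellMeasure P Ψ).restrict (unitSquare ×ˢ Set.univ)).map Prod.snd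
  have hν : ∀ Γ, MeasurableSet Γ → ν Γ = campbellMeasure P Ψ (unitSquare ×ˢ Γ) := by
    intro Γ hΓ
    rw [Measure.map_apply measurable_snd hΓ, Measure.restrict_apply (measurable_snd hΓ)]
    congr 1
    ext q
    simp [and_comm]
  refine ⟨(intensity P Ψ)⁻¹ • ν, hΨ, hpos, hfin, ⟨?_⟩, fun A Γ hA hΓ => ?_⟩
  · rw [Measure.smul_apply, hν _ MeasurableSet.univ, campbellMeasure_unitSquare hΨ.measurable,
      smul_eq_mul, ENNReal.inv_mul_cancel hpos.ne' hfin.ne]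
  · rw [← campbellMeasure_prod hΨ.measurable hA hΓ, campbellMeasure_prod_eq hΨ hfin hA hΓ,
      Measure.smul_apply, hν _ hΓ, smul_eq_mul, mul_right_comm, ← mul_assoc (intensity P Ψ),
      ENNReal.mul_inv_cancel hpos.ne' hfin.ne, one_mul]

theorem IsPalm.intensity_mul {Q : Measure Config} (h : IsPalm P Ψ Q) {Γ : Set Config}
    (hΓ : MeasurableSet Γ) :
    intensity P Ψ * Q Γ = ∫⁻ ω, ∑' x : (Ψ ω).atoms, unitSquare.indicator 1 (x : Plane) *
        Γ.indicator 1 ((Ψ ω).translate (-(x : Plane))) ∂P := by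
  rw [h.campbell _ _ measurableSet_unitSquare hΓ, volume_unitSquare, mul_one]

theorem IsPalm.eq {Q Q' : Measure Config} (h : IsPalm P Ψ Q) (h' : IsPalm P Ψ Q') : Q = Q' := by
  ext Γ hΓ
  have e := (h.intensity_mul hΓ).trans (h'.intensity_mul hΓ).symm
  exact (ENNReal.mul_right_inj h.intensity_pos.ne' h.intensity_lt_top.ne).1 e

theorem existsUnique_isPalm [IsProbabilityMeasure P] (hΨ : IsStationary P Ψ)
    (hpos : 0 < intensity P Ψ) (hfin : intensity P Ψ < ∞) : ∃! Q, IsPalm P Ψ Q := by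
  obtain ⟨Q, hQ⟩ := exists_isPalm hΨ hpos hfin
  exact ⟨Q, hQ, fun Q' hQ' => hQ'.eq hQ⟩

theorem IsStationary.paired (hΨ : IsStationary P Ψ) :
    IsStationary P fun ω => (Ψ ω).paired := by
  refine ⟨measurable_paired.comp hΨ.measurable, fun v => ?_⟩
  have hv : Measurable fun ω => (Ψ ω).translate v :=
    measurable_translate hΨ.measurable measurable_const
  calc P.map (fun ω => (Ψ ω).paired.translate v)
      = (P.map (fun ω => (Ψ ω).translate v)).map Config.paired := by
        rw [Measure.map_map measurable_paired hv]
        simp only [Function.comp_def, paired_translate]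
    _ = P.map (fun ω => (Ψ ω).paired) := by
        rw [hΨ.map_translate v, Measure.map_map measurable_paired hΨ.measurable]
        rfl

theorem intensity_paired_le : intensity P (fun ω => (Ψ ω).paired) ≤ intensity P Ψ := by
  refine lintegral_mono fun ω => ?_
  have : (Ψ ω).paired.count unitSquare ≤ (Ψ ω).count unitSquare :=
    Set.encard_le_encard (Set.inter_subset_inter_left _ fun x hx => hx.1)
  exact ENat.toENNReal_le.2 this

open Classical in
theorem tsum_atoms_paired (φ : Config) (f : Plane → ℝ≥0∞) :
    ∑' x : φ.paired.atoms, f x = ∑' x : φ.atoms, φ.paired.atoms.indicator f x := by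
  rw [tsum_subtype φ.paired.atoms f, tsum_subtype φ.atoms]
  refine tsum_congr fun x => ?_
  by_cases h : x ∈ φ.paired.atoms
  · have h' : x ∈ φ.atoms := h.1
    simp [h, h']
  · rw [Set.indicator_of_notMem h, Set.indicator_apply, Set.indicator_of_notMem h, ite_self]

theorem measurableSet_zero_mem_paired : MeasurableSet {φ : Config | (0 : Plane) ∈ φ.paired.atoms} :=
  measurableSet_mem_atoms measurable_paired measurable_const

/-- The Palm measure of the process of pairs is the image of the conditioned Palm measure. -/
theorem IsPalm.eq_map_cond {P₀ Q : Measure Config} (h : IsPalm P Ψ P₀)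
    (hQ : IsPalm P (fun ω => (Ψ ω).paired) Q) :
    Q = (cond P₀ {φ : Config | (0 : Plane) ∈ φ.paired.atoms}).map Config.paired := by
  have := h.isProbabilityMeasure
  have := hQ.isProbabilityMeasure
  set E : Set Config := {φ : Config | (0 : Plane) ∈ φ.paired.atoms} with hE
  have hEm : MeasurableSet E := measurableSet_zero_mem_paired
  have key : ∀ Γ, MeasurableSet Γ → intensity P (fun ω => (Ψ ω).paired) * Q Γ =
      intensity P Ψ * P₀ (E ∩ Config.paired ⁻¹' Γ) := by
    intro Γ hΓ
    rw [hQ.intensity_mul hΓ, h.intensity_mul (hEm.inter (measurable_paired hΓ))]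
    refine lintegral_congr fun ω => ?_
    rw [tsum_atoms_paired (Ψ ω) (fun x => unitSquare.indicator 1 x *
      Γ.indicator 1 ((Ψ ω).paired.translate (-x)))]
    refine tsum_congr fun x => ?_
    -- Seen from the atom `x`, the origin is paired exactly when `x` is; this turns the restriction
    -- to paired atoms into an event for the Palm measure of `Ψ`.
    have h1 : (Ψ ω).translate (-x) ∈ E ↔ (x : Plane) ∈ (Ψ ω).paired.atoms := by
      rw [hE, Set.mem_ofPred_eq, paired_translate, mem_atoms_translate, sub_neg_eq_add, zero_add]
    by_cases hx : (x : Plane) ∈ (Ψ ω).paired.atoms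
    · rw [Set.indicator_of_mem hx]
      congr 1
      classical
      simp only [Set.indicator_apply, Set.mem_inter_iff, h1, hx, true_and, Set.mem_preimage,
        paired_translate, Pi.one_apply]
    · rw [Set.indicator_of_notMem hx, Set.indicator_of_notMem (s := E ∩ _) (fun h' => hx (h1.1 h'.1)),
        mul_zero]
  have h2 : intensity P (fun ω => (Ψ ω).paired) = intensity P Ψ * P₀ E := by
    simpa using key _ MeasurableSet.univ
  have hE0 : P₀ E ≠ 0 := by
    intro h0
    rw [h0, mul_zero] at h2
    exact hQ.intensity_pos.ne' h2
  ext Γ hΓ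
  rw [Measure.map_apply measurable_paired hΓ, cond_apply hEm]
  have h3 := key Γ hΓ
  rw [h2, mul_assoc, ENNReal.mul_right_inj h.intensity_pos.ne' h.intensity_lt_top.ne] at h3
  rw [← h3, ← mul_assoc, ENNReal.inv_mul_cancel hE0 (measure_ne_top _ _), one_mul]

end NNPairs

/-! ### Poisson processes and the Mecke formula -/

namespace NNPairs

open Config

/-- The weights satisfy `(n + 1) p(n + 1) = r p(n)`, so the mean is `r` times the total mass. -/
theorem lintegral_natCast_poissonMeasure (r : ℝ≥0) :
    ∫⁻ n : ℕ, (n : ℝ≥0∞) ∂(poissonMeasure r) = r := by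
  have h1 : ∫⁻ n : ℕ, (n : ℝ≥0∞) ∂(poissonMeasure r) =
      ∑' n : ℕ, (n : ℝ≥0∞) * poissonMeasure r {n} := lintegral_countable' _
  have h2 : ∀ n : ℕ, ((n + 1 : ℕ) : ℝ≥0∞) * poissonMeasure r {n + 1} =
      r * poissonMeasure r {n} := by
    intro n
    rw [poissonMeasure_singleton, poissonMeasure_singleton, ← ENNReal.ofReal_natCast,
      ← ENNReal.ofReal_coe_nnreal, ← ENNReal.ofReal_mul (by positivity),
      ← ENNReal.ofReal_mul (by positivity), Nat.factorial_succ]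
    congr 1
    push_cast
    field_simp
    ring
  have h3 : ∑' n : ℕ, poissonMeasure r {n} = 1 := by
    have := (lintegral_countable' (μ := poissonMeasure r) (fun _ : ℕ => (1 : ℝ≥0∞))).symm
    simpa using this
  rw [h1, tsum_eq_zero_add' ENNReal.summable]
  simp_rw [h2]
  rw [ENNReal.tsum_mul_left, h3]
  simp

variable {Ω : Type*} [MeasurableSpace Ω] {P : Measure Ω} {lam : ℝ≥0} {Φ : Ω → Config}

/-- The probability that a Poisson process of density `lam` has no atoms in `B`. -/
noncomputable def voidProb (lam : ℝ≥0) (B : Set Plane) : ℝ≥0∞ :=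
  ENNReal.ofReal (Real.exp (-(lam * volume.real B)))

theorem voidProb_union {A B : Set Plane} (hB : MeasurableSet B) (hd : Disjoint A B)
    (hA' : volume A ≠ ∞) (hB' : volume B ≠ ∞) :
    voidProb lam (A ∪ B) = voidProb lam A * voidProb lam B := by
  rw [voidProb, voidProb, voidProb, ← ENNReal.ofReal_mul (by positivity), ← Real.exp_add,
    measureReal_union hd hB hA' hB']
  congr 2
  ring

namespace IsPoissonProcess

theorem measurable_count (h : IsPoissonProcess P Φ lam) {B : Set Plane} (hB : MeasurableSet B) :
    Measurable fun ω => (Φ ω).count B :=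
  (Config.measurable_count hB).comp h.measurable

theorem prob_count_eq (h : IsPoissonProcess P Φ lam) {B : Set Plane} (hB : MeasurableSet B)
    (hB' : volume B ≠ ∞) (k : ℕ) :
    P {ω | (Φ ω).count B = k} = poissonMeasure (lam * (volume B).toNNReal) {k} := by
  have h1 := congrArg (fun μ => μ {(k : ℕ∞)}) (h.count_law B hB hB')
  rw [Measure.map_apply (h.measurable_count hB) (.of_discrete),
    Measure.map_apply .of_discrete (.of_discrete)] at h1
  have e : ((fun n : ℕ => (n : ℕ∞)) ⁻¹' {(k : ℕ∞)}) = {k} := by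
    ext n
    simp
  rwa [e] at h1

theorem prob_void (h : IsPoissonProcess P Φ lam) {B : Set Plane} (hB : MeasurableSet B)
    (hB' : volume B ≠ ∞) : P {ω | Φ ω ∈ void B} = voidProb lam B := by
  have h1 := h.prob_count_eq hB hB' 0
  rw [poissonMeasure_singleton] at h1
  simp_rw [mem_void_iff]
  simpa [voidProb, measureReal_def, ENNReal.coe_toNNReal_eq_toReal] using h1

theorem prob_count_eq_one (h : IsPoissonProcess P Φ lam) {B : Set Plane} (hB : MeasurableSet B)
    (hB' : volume B ≠ ∞) : P {ω | (Φ ω).count B = 1} = lam * volume B * voidProb lam B := by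
  have h1 := h.prob_count_eq hB hB' 1
  rw [poissonMeasure_singleton] at h1
  rw [show P {ω | (Φ ω).count B = 1} = _ from h1, voidProb, mul_comm, Nat.factorial_one,
    Nat.cast_one, div_one, pow_one, ENNReal.ofReal_mul (by positivity), ENNReal.ofReal_coe_nnreal]
  congr 1
  rw [ENNReal.coe_mul, ENNReal.coe_toNNReal hB']

theorem lintegral_count (h : IsPoissonProcess P Φ lam) {B : Set Plane} (hB : MeasurableSet B)
    (hB' : volume B ≠ ∞) : ∫⁻ ω, ((Φ ω).count B : ℝ≥0∞) ∂P = lam * volume B := by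
  have h1 := congrArg (fun μ => ∫⁻ n : ℕ∞, (n : ℝ≥0∞) ∂μ) (h.count_law B hB hB')
  rw [lintegral_map .of_discrete (h.measurable_count hB),
    lintegral_map .of_discrete .of_discrete] at h1
  rw [h1]
  simp only [ENat.toENNReal_coe]
  rw [lintegral_natCast_poissonMeasure, ENNReal.coe_mul, ENNReal.coe_toNNReal hB']

theorem indepFun (h : IsPoissonProcess P Φ lam) {A B : Set Plane} (hA : MeasurableSet A)
    (hB : MeasurableSet B) (hd : Disjoint A B) :
    IndepFun (fun ω => (Φ ω).count A) (fun ω => (Φ ω).count B) P := by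
  have h1 := h.indep 2 ![A, B] (by intro i; fin_cases i <;> assumption) (by
    intro i j hij
    fin_cases i <;> fin_cases j <;> first | exact absurd rfl hij | exact hd | exact hd.symm)
  exact h1.indepFun (i := 0) (j := 1) (by decide)

/-- Void probabilities depend only on area, which translations preserve, and they determine the law.
-/
theorem isStationary [IsProbabilityMeasure P] (h : IsPoissonProcess P Φ lam) :
    IsStationary P Φ := by
  refine ⟨h.measurable, fun v => ?_⟩
  have hv : Measurable fun ω => (Φ ω).translate v :=
    measurable_translate h.measurable measurable_const
  have := Measure.isProbabilityMeasure_map hv.aemeasurable (μ := P)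
  have := Measure.isProbabilityMeasure_map h.measurable.aemeasurable (μ := P)
  refine ext_of_void fun B hB hB' => ?_
  rw [Measure.map_apply hv (measurableSet_void hB),
    Measure.map_apply h.measurable (measurableSet_void hB)]
  have hvol : volume ((fun x => x + v) ⁻¹' B) = volume B := measure_preimage_add_right _ _ _
  have h1 := h.prob_void (measurable_add_const v hB) (by rwa [hvol])
  have h2 := h.prob_void hB hB'
  rw [voidProb, measureReal_def, hvol] at h1
  rw [voidProb, measureReal_def] at h2
  refine Eq.trans ?_ (h1.trans h2.symm)
  congr 1
  ext ω
  simp only [Set.mem_preimage, mem_void, Set.mem_ofPred_eq, Set.eq_empty_iff_forall_notMem,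
    Set.mem_inter_iff, mem_atoms_translate, not_and]
  rw [← (Equiv.subRight v).forall_congr_right (q := fun x => x ∈ (Φ ω).atoms → x + v ∉ B)]
  simp [Equiv.subRight]

theorem intensity_eq [IsProbabilityMeasure P] (h : IsPoissonProcess P Φ lam) :
    intensity P Φ = lam := by
  have := h.lintegral_count measurableSet_unitSquare (by simp [volume_unitSquare])
  rwa [volume_unitSquare, mul_one] at this

end IsPoissonProcess

/-- An atom in `A \ B` contributes when `B` is empty, since erasing it does not affect `B`. An atom
in `A ∩ B` contributes when it is the only atom of `B`. Each resulting term is a product of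
functions of counts in disjoint sets, ready for independence. -/
theorem tsum_erase_void (φ : Config) (A B : Set Plane) :
    ∑' x : φ.atoms, (A.indicator 1 (x : Plane) * (void B).indicator 1 (φ.erase x) : ℝ≥0∞) =
      φ.count (A \ B) * Set.indicator {0} 1 (φ.count B) +
      Set.indicator {1} 1 (φ.count (A ∩ B)) * Set.indicator {0} 1 (φ.count (B \ A)) := by
  have hsplit : ∀ x : φ.atoms,
      (A.indicator 1 (x : Plane) * (void B).indicator 1 (φ.erase x) : ℝ≥0∞) =
        (A \ B).indicator 1 (x : Plane) * Set.indicator {0} 1 (φ.count B) +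
        (A ∩ B).indicator 1 (x : Plane) * (void B).indicator 1 (φ.erase x) := by
    intro x
    by_cases hA : (x : Plane) ∈ A
    · by_cases hB : (x : Plane) ∈ B
      · simp [hA, hB]
      · have : φ.erase x ∈ void B ↔ φ.count B = 0 := by
          rw [← mem_void_iff, mem_void, mem_void, atoms_erase, ← Set.inter_sdiff_right_comm,
            Set.sdiff_singleton_eq_self (fun h => hB h.2)]
        by_cases h0 : φ.count B = 0 <;> simp [hA, hB, this, h0]
    · simp [hA]
  have key : ∀ x ∈ φ.atoms, x ∈ A ∩ B → (φ.erase x ∈ void B ↔ φ.atoms ∩ B = {x}) := by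
    intro x hx hxB
    rw [mem_void, atoms_erase, ← Set.inter_sdiff_right_comm, Set.sdiff_eq_empty,
      Set.Nonempty.subset_singleton_iff (⟨x, hx, hxB.2⟩ : (φ.atoms ∩ B).Nonempty)]
  simp_rw [hsplit]
  rw [ENNReal.tsum_add, ENNReal.tsum_mul_right, ← cast_count]
  congr 1
  by_cases hc : φ.count (A ∩ B) = 1 ∧ φ.count (B \ A) = 0
  · obtain ⟨x₀, hx₀⟩ := Set.encard_eq_one.1 hc.1
    have hx : x₀ ∈ φ.atoms ∩ (A ∩ B) := hx₀ ▸ Set.mem_singleton x₀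
    have hB : φ.atoms ∩ B = {x₀} := by
      have h2 : φ.atoms ∩ (B \ A) = ∅ := mem_void_iff.2 hc.2
      have : φ.atoms ∩ B = φ.atoms ∩ (A ∩ B) ∪ φ.atoms ∩ (B \ A) := by
        rw [← Set.inter_union_distrib_left, Set.inter_comm A B, Set.inter_union_sdiff]
      rw [this, h2, hx₀, Set.union_empty]
    rw [tsum_eq_single (⟨x₀, hx.1⟩ : φ.atoms)]
    · simp [hx.2.1, hx.2.2, (key x₀ hx.1 hx.2).2 hB, hc.1, hc.2]
    · intro y hy
      have : (y : Plane) ∉ A ∩ B := fun h => hy (Subtype.ext (by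
        have : (y : Plane) ∈ φ.atoms ∩ (A ∩ B) := ⟨y.2, h⟩
        rw [hx₀] at this
        exact this))
      rw [Set.indicator_of_notMem this, zero_mul]
  · have hr : (Set.indicator {1} 1 (φ.count (A ∩ B)) *
        Set.indicator {0} 1 (φ.count (B \ A)) : ℝ≥0∞) = 0 := by
      rcases not_and_or.1 hc with h | h <;> simp [h]
    rw [hr, ENNReal.tsum_eq_zero]
    intro x
    by_contra hne
    have h1 : (x : Plane) ∈ A ∩ B := by
      by_contra h
      exact hne (by rw [Set.indicator_of_notMem h, zero_mul])
    have h2 : φ.erase x ∈ void B := by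
      by_contra h
      exact hne (by rw [Set.indicator_of_notMem h, mul_zero])
    have h3 := (key x x.2 h1).1 h2
    refine hc ⟨?_, ?_⟩
    · rw [count, Set.encard_eq_one]
      refine ⟨x, subset_antisymm ?_ (Set.singleton_subset_iff.2 ⟨x.2, h1⟩)⟩
      exact (Set.inter_subset_inter_right _ Set.inter_subset_right).trans h3.subset
    · rw [← mem_void_iff, mem_void, Set.eq_empty_iff_forall_notMem]
      rintro z ⟨hz, hzB, hzA⟩
      have : z ∈ ({(x : Plane)} : Set Plane) := h3 ▸ ⟨hz, hzB⟩
      rw [Set.mem_singleton_iff.1 this] at hzA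
      exact hzA h1.1

namespace IsPoissonProcess

theorem lintegral_tsum_erase_void [IsProbabilityMeasure P] (h : IsPoissonProcess P Φ lam)
    {A B : Set Plane} (hA : MeasurableSet A) (hB : MeasurableSet B) (hA' : volume A ≠ ∞)
    (hB' : volume B ≠ ∞) :
    ∫⁻ ω, ∑' x : (Φ ω).atoms,
        A.indicator 1 (x : Plane) * (void B).indicator 1 ((Φ ω).erase x) ∂P =
      lam * volume A * voidProb lam B := by
  have hm : ∀ {C : Set Plane}, MeasurableSet C → ∀ f : ℕ∞ → ℝ≥0∞,
      Measurable fun ω => f ((Φ ω).count C) := fun hC f =>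
    (Measurable.of_discrete (f := f)).comp (h.measurable_count hC)
  have hi : ∀ (C : Set Plane) (n : ℕ∞), MeasurableSet C →
      ∫⁻ ω, Set.indicator {n} 1 ((Φ ω).count C) ∂P = P {ω | (Φ ω).count C = n} := by
    intro C n hC
    have hCn : MeasurableSet {ω | (Φ ω).count C = n} :=
      h.measurable_count hC (.of_discrete (s := ({n} : Set ℕ∞)))
    rw [← lintegral_indicator_one hCn]
    rfl
  have hfin : ∀ {C : Set Plane}, C ⊆ B → volume C ≠ ∞ := fun hC =>
    ((measure_mono hC).trans_lt hB'.lt_top).ne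
  have hAB : volume (A \ B) ≠ ∞ := ((measure_mono Set.sdiff_subset).trans_lt hA'.lt_top).ne
  have e1 : ∫⁻ ω, ((Φ ω).count (A \ B) : ℝ≥0∞) * Set.indicator {0} 1 ((Φ ω).count B) ∂P =
      lam * volume (A \ B) * voidProb lam B := by
    have hind := (h.indepFun (hA.diff hB) hB Set.disjoint_sdiff_left).comp
      (φ := fun n : ℕ∞ => (n : ℝ≥0∞)) (ψ := Set.indicator {0} (1 : ℕ∞ → ℝ≥0∞))
      .of_discrete .of_discrete
    have := lintegral_mul_eq_lintegral_mul_lintegral_of_indepFun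
      (hm (hA.diff hB) (fun n : ℕ∞ => (n : ℝ≥0∞))) (hm hB (Set.indicator {0} 1)) hind
    simp only [Pi.mul_apply] at this
    rw [this, h.lintegral_count (hA.diff hB) hAB, hi _ _ hB]
    simp_rw [← mem_void_iff]
    rw [h.prob_void hB hB']
  have e2 : ∫⁻ ω, Set.indicator {1} 1 ((Φ ω).count (A ∩ B)) *
        Set.indicator {0} 1 ((Φ ω).count (B \ A)) ∂P =
      lam * volume (A ∩ B) * voidProb lam B := by
    have hd : Disjoint (A ∩ B) (B \ A) := Set.disjoint_sdiff_right.mono_left Set.inter_subset_left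
    have hind := (h.indepFun (hA.inter hB) (hB.diff hA) hd).comp
      (φ := Set.indicator {1} (1 : ℕ∞ → ℝ≥0∞)) (ψ := Set.indicator {0} (1 : ℕ∞ → ℝ≥0∞))
      .of_discrete .of_discrete
    have := lintegral_mul_eq_lintegral_mul_lintegral_of_indepFun
      (hm (hA.inter hB) (Set.indicator {1} 1)) (hm (hB.diff hA) (Set.indicator {0} 1)) hind
    simp only [Pi.mul_apply] at this
    rw [this, hi _ _ (hA.inter hB), hi _ _ (hB.diff hA)]
    simp_rw [← mem_void_iff]
    rw [h.prob_void (hB.diff hA) (hfin Set.sdiff_subset),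
      h.prob_count_eq_one (hA.inter hB) (hfin Set.inter_subset_right), mul_assoc,
      ← voidProb_union (hB.diff hA) hd (hfin Set.inter_subset_right) (hfin Set.sdiff_subset),
      Set.inter_comm A B, Set.inter_union_sdiff]
  simp_rw [tsum_erase_void]
  rw [lintegral_add_left (f := fun ω => ((Φ ω).count (A \ B) : ℝ≥0∞) * Set.indicator {0} 1 ((Φ ω).count B))
    ((hm (hA.diff hB) (fun n : ℕ∞ => (n : ℝ≥0∞))).mul
    (hm hB (Set.indicator {0} 1))), e1, e2, ← add_mul, ← mul_add,
    add_comm (volume (A \ B)), measure_inter_add_sdiff A hB]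

/-- The reduced Campbell measure of a Poisson process is the product of the intensity measure and
the law of the process. -/
theorem map_compProd_pointsKernel [IsProbabilityMeasure P] (h : IsPoissonProcess P Φ lam) :
    ((lam : ℝ≥0∞) • (volume : Measure Plane)).prod (P.map Φ) =
      (P.map Φ ⊗ₘ pointsKernel).map fun q => (q.2, q.1.erase q.2) := by
  have := Measure.isProbabilityMeasure_map h.measurable.aemeasurable (μ := P)
  let C : Set (Set Plane) := {A | MeasurableSet A ∧ volume A ≠ ∞}
  have hball : ∀ n : ℕ, Metric.closedBall (0 : Plane) n ∈ C := fun n =>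
    ⟨Metric.isClosed_closedBall.measurableSet, measure_closedBall_lt_top.ne⟩
  have hC : MeasurableSpace.generateFrom C = (inferInstance : MeasurableSpace Plane) := by
    refine le_antisymm (MeasurableSpace.generateFrom_le fun A hA => hA.1) fun A hA => ?_
    have : A = ⋃ n : ℕ, A ∩ Metric.closedBall 0 n := by
      rw [← Set.inter_iUnion, Metric.iUnion_closedBall_nat, Set.inter_univ]
    rw [this]
    exact MeasurableSet.iUnion fun n => MeasurableSpace.measurableSet_generateFrom
      ⟨hA.inter (hball n).1,
        ((measure_mono Set.inter_subset_right).trans_lt measure_closedBall_lt_top).ne⟩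
  -- Both factors have generating π-systems with σ-finite exhaustions, so equality on rectangles `A
  -- ×ˢ void B` with finite areas is enough.
  refine Measure.prod_eq_generateFrom hC generateFrom_voids ?_ isPiSystem_voids
    ⟨fun n : ℕ => Metric.closedBall 0 n, hball, fun n => ?_, Metric.iUnion_closedBall_nat 0⟩
    ⟨fun _ => Set.univ, fun _ => univ_mem_voids, fun _ => measure_lt_top _ _, Set.iUnion_const _⟩ ?_
  · rintro A ⟨hA, hA'⟩ B ⟨hB, hB'⟩ -
    exact ⟨hA.inter hB, ((measure_mono Set.inter_subset_left).trans_lt hA'.lt_top).ne⟩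
  · rw [Measure.smul_apply, smul_eq_mul]
    exact ENNReal.mul_lt_top ENNReal.coe_lt_top measure_closedBall_lt_top
  · rintro A ⟨hA, hA'⟩ _ ⟨B, hB, hB', rfl⟩
    have hm : Measurable fun q : Config × Plane => (q.2, q.1.erase q.2) :=
      measurable_snd.prodMk (measurable_erase measurable_fst measurable_snd)
    have hi : Measurable ((A ×ˢ void B).indicator (1 : Plane × Config → ℝ≥0∞)) :=
      measurable_one.indicator (hA.prod (measurableSet_void hB))
    rw [← lintegral_indicator_one (hA.prod (measurableSet_void hB)), lintegral_map hi hm,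
      lintegral_map_compProd_pointsKernel h.measurable
        (f := fun q => (A ×ˢ void B).indicator 1 (q.2, q.1.erase q.2)) (hi.comp hm)]
    simp only [Set.indicator_prod_one]
    rw [h.lintegral_tsum_erase_void hA hB hA' hB', Measure.smul_apply, smul_eq_mul,
      Measure.map_apply h.measurable (measurableSet_void hB), ← h.prob_void hB hB']
    rfl

/-- The Mecke formula. -/
theorem lintegral_tsum_erase [IsProbabilityMeasure P] (h : IsPoissonProcess P Φ lam)
    {f : Plane × Config → ℝ≥0∞} (hf : Measurable f) :
    ∫⁻ ω, ∑' x : (Φ ω).atoms, f (x, (Φ ω).erase x) ∂P =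
      lam * ∫⁻ x, ∫⁻ ω, f (x, Φ ω) ∂P := by
  have := Measure.isProbabilityMeasure_map h.measurable.aemeasurable (μ := P)
  have hm : Measurable fun q : Config × Plane => (q.2, q.1.erase q.2) :=
    measurable_snd.prodMk (measurable_erase measurable_fst measurable_snd)
  have h1 := lintegral_map_compProd_pointsKernel (P := P) h.measurable
        (f := fun q => f (q.2, q.1.erase q.2)) (hf.comp hm)
  rw [← h1, ← lintegral_map hf hm, ← h.map_compProd_pointsKernel,
    lintegral_prod _ hf.aemeasurable, lintegral_smul_measure]
  congr 1
  refine lintegral_congr fun x => ?_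
  exact lintegral_map (hf.comp measurable_prodMk_left) h.measurable

end IsPoissonProcess

end NNPairs

/-! ### Area of two overlapping discs, and polar coordinates -/

namespace NNPairs

theorem measurePreserving_planePoint :
    MeasurePreserving fun p : ℝ × ℝ => (!₂[p.1, p.2] : Plane) := by
  have h := (PiLp.volume_preserving_toLp (Fin 2)).comp (volume_preserving_finTwoArrow ℝ).symm
  have e : (fun p : ℝ × ℝ => (!₂[p.1, p.2] : Plane)) =
      WithLp.toLp 2 ∘ MeasurableEquiv.finTwoArrow.symm := by
    ext p i
    fin_cases i <;> rfl
  rw [e]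
  exact h

theorem mem_slice_lens_iff (s t : ℝ) :
    (!₂[s, t] : Plane) ∈ Metric.closedBall (0 : Plane) 1 ∩ Metric.closedBall !₂[0, 1] 1 ↔
      t ∈ Set.Icc (1 - √(1 - s ^ 2)) (√(1 - s ^ 2)) := by
  have h1 : (!₂[s, t] : Plane) ∈ Metric.closedBall (0 : Plane) 1 ↔ s ^ 2 + t ^ 2 ≤ 1 := by
    rw [Metric.mem_closedBall, EuclideanSpace.dist_eq, Real.sqrt_le_iff]
    simp [Fin.sum_univ_two]
  have h2 : (!₂[s, t] : Plane) ∈ Metric.closedBall (!₂[0, 1] : Plane) 1 ↔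
      s ^ 2 + (t - 1) ^ 2 ≤ 1 := by
    rw [Metric.mem_closedBall, EuclideanSpace.dist_eq, Real.sqrt_le_iff]
    simp [Fin.sum_univ_two, Real.dist_eq]
  rw [Set.mem_inter_iff, h1, h2, Set.mem_Icc]
  have hq0 := Real.sqrt_nonneg (1 - s ^ 2)
  rcases le_total (s ^ 2) 1 with hs | hs
  · have hq := Real.sq_sqrt (sub_nonneg.2 hs)
    set q := √(1 - s ^ 2)
    have hq1 : q ≤ 1 := by nlinarith [sq_nonneg s]
    constructor
    · rintro ⟨ha, hb⟩
      have ha' := abs_le.1 (abs_le_of_sq_le_sq (show t ^ 2 ≤ q ^ 2 by linarith) hq0)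
      have hb' := abs_le.1 (abs_le_of_sq_le_sq (show (t - 1) ^ 2 ≤ q ^ 2 by linarith) hq0)
      constructor <;> linarith [ha'.1, ha'.2, hb'.1, hb'.2]
    · rintro ⟨ha, hb⟩
      have ha' : t ^ 2 ≤ q ^ 2 := sq_le_sq' (by linarith) hb
      have hb' : (t - 1) ^ 2 ≤ q ^ 2 := sq_le_sq' (by linarith) (by linarith)
      constructor <;> linarith
  -- Here the square root is zero, so the interval is `Icc 1 0`, which is empty, as is the slice.
  · rw [Real.sqrt_eq_zero_of_nonpos (by linarith)]
    constructor
    · rintro ⟨ha, hb⟩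
      exfalso
      nlinarith [sq_nonneg t, sq_nonneg (t - 1)]
    · rintro ⟨ha, hb⟩
      linarith

/-- An antiderivative is `s√(1 - s²) + arcsin s - s`. The limits are the abscissas where `√(1 - s²)
= 1/2`, that is, where the slice shrinks to a point. -/
theorem integral_lens_slices :
    ∫ s in (-(√3 / 2))..(√3 / 2), (2 * √(1 - s ^ 2) - 1) = 2 * Real.pi / 3 - √3 / 2 := by
  have h3 : √3 ^ 2 = 3 := Real.sq_sqrt (by norm_num)
  have h30 := Real.sqrt_nonneg 3
  have hlt : √3 / 2 < 1 := by nlinarith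
  have hderiv : ∀ s ∈ Set.uIcc (-(√3 / 2)) (√3 / 2),
      HasDerivAt (fun s => s * √(1 - s ^ 2) + Real.arcsin s - s) (2 * √(1 - s ^ 2) - 1) s := by
    intro s hs
    rw [Set.uIcc_of_le (by linarith)] at hs
    have hs1 : -1 < s := by linarith [hs.1]
    have hs2 : s < 1 := by linarith [hs.2]
    have hpos : 0 < 1 - s ^ 2 := by nlinarith
    have hq := Real.sq_sqrt hpos.le
    have hq0 : √(1 - s ^ 2) ≠ 0 := (Real.sqrt_pos.2 hpos).ne'
    have d1 : HasDerivAt (fun s : ℝ => 1 - s ^ 2) (-(2 * s)) s := by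
      simpa using (hasDerivAt_pow 2 s).const_sub 1
    have d2 := ((hasDerivAt_id s).mul (d1.sqrt hpos.ne')).add
      (Real.hasDerivAt_arcsin hs1.ne' hs2.ne) |>.sub (hasDerivAt_id s)
    have e : 2 * √(1 - s ^ 2) - 1 =
        1 * √(1 - s ^ 2) + id s * (-(2 * s) / (2 * √(1 - s ^ 2))) + 1 / √(1 - s ^ 2) - 1 := by
      simp only [id]
      field_simp
      linear_combination hq
    rw [e]
    exact d2
  rw [intervalIntegral.integral_eq_sub_of_hasDerivAt hderiv
    (Continuous.intervalIntegrable (by fun_prop) _ _)]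
  have hq : √(1 - (√3 / 2) ^ 2) = 1 / 2 := by
    rw [Real.sqrt_eq_iff_mul_self_eq (by nlinarith) (by norm_num)]
    nlinarith
  have ha : Real.arcsin (√3 / 2) = Real.pi / 3 :=
    Real.arcsin_eq_of_sin_eq Real.sin_pi_div_three
      ⟨by linarith [Real.pi_pos], by linarith [Real.pi_pos]⟩
  rw [Real.arcsin_neg, ha, neg_sq, hq]
  ring

/-- The area of the intersection of two unit discs, each centred on the boundary of the other. -/
theorem volume_unit_lens :
    volume (Metric.closedBall (0 : Plane) 1 ∩ Metric.closedBall !₂[0, 1] 1) =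
      ENNReal.ofReal (2 * Real.pi / 3 - √3 / 2) := by
  have hm : MeasurableSet (Metric.closedBall (0 : Plane) 1 ∩ Metric.closedBall !₂[0, 1] 1) :=
    Metric.isClosed_closedBall.measurableSet.inter Metric.isClosed_closedBall.measurableSet
  have h3 : √3 ^ 2 = 3 := Real.sq_sqrt (by norm_num)
  have h30 := Real.sqrt_nonneg 3
  rw [← measurePreserving_planePoint.measure_preimage hm.nullMeasurableSet,
    Measure.volume_eq_prod, Measure.prod_apply (measurePreserving_planePoint.measurable hm)]
  have hslice : ∀ s : ℝ, volume (Prod.mk s ⁻¹' ((fun p : ℝ × ℝ => (!₂[p.1, p.2] : Plane)) ⁻¹'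
      (Metric.closedBall (0 : Plane) 1 ∩ Metric.closedBall !₂[0, 1] 1))) =
        (Set.Ioc (-(√3 / 2)) (√3 / 2)).indicator
          (fun s => ENNReal.ofReal (2 * √(1 - s ^ 2) - 1)) s := by
    intro s
    have : (Prod.mk s ⁻¹' ((fun p : ℝ × ℝ => (!₂[p.1, p.2] : Plane)) ⁻¹'
      (Metric.closedBall (0 : Plane) 1 ∩ Metric.closedBall !₂[0, 1] 1))) =
        Set.Icc (1 - √(1 - s ^ 2)) (√(1 - s ^ 2)) := by
      ext t
      exact mem_slice_lens_iff s t
    rw [this, Real.volume_Icc]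
    by_cases hs : s ∈ Set.Ioc (-(√3 / 2)) (√3 / 2)
    · rw [Set.indicator_of_mem hs]
      congr 1
      ring
    -- Outside the interval the formal length `2√(1 - s²) - 1` is nonpositive and `ENNReal.ofReal`
    -- truncates it to zero.
    · rw [Set.indicator_of_notMem hs, ENNReal.ofReal_eq_zero]
      have hs2 : 3 / 4 ≤ s ^ 2 := by
        rw [Set.mem_Ioc, not_and_or, not_lt, not_le] at hs
        rcases hs with hs | hs <;> nlinarith
      have : √(1 - s ^ 2) ≤ 1 / 2 := Real.sqrt_le_iff.2 ⟨by norm_num, by linarith⟩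
      linarith
  simp_rw [hslice]
  rw [lintegral_indicator measurableSet_Ioc, ← integral_lens_slices,
    intervalIntegral.integral_of_le (by linarith), ofReal_integral_eq_lintegral_ofReal]
  · exact (Continuous.intervalIntegrable (by fun_prop) _ _).1
  · refine (ae_restrict_mem measurableSet_Ioc).mono fun s hs => ?_
    have : 1 / 2 ≤ √(1 - s ^ 2) := Real.le_sqrt_of_sq_le (by nlinarith [hs.1, hs.2])
    simp only [Pi.zero_apply]
    linarith

/-- A translation, a scaling by `ρ⁻¹` and an isometry carry the lens to the unit lens; the area
scales by `ρ²`. -/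
theorem volume_lens {x y : Plane} (hxy : x ≠ y) :
    volume (Metric.closedBall x (dist x y) ∩ Metric.closedBall y (dist x y)) =
      ENNReal.ofReal ((2 * Real.pi / 3 - √3 / 2) * dist x y ^ 2) := by
  have hρ : 0 < dist x y := dist_pos.2 hxy
  set ρ := dist x y with hρd
  have he : ‖(!₂[0, 1] : Plane)‖ = 1 := by
    rw [EuclideanSpace.norm_eq]
    simp [Fin.sum_univ_two]
  have hu : ‖ρ⁻¹ • (y - x)‖ = ‖(!₂[0, 1] : Plane)‖ := by
    rw [he, norm_smul, ← dist_eq_norm, dist_comm y x, ← hρd, Real.norm_of_nonneg (by positivity),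
      inv_mul_cancel₀ hρ.ne']
  -- Reflection in the line orthogonal to the difference of two vectors of equal norm maps one to
  -- the other.
  let R : Plane ≃ₗᵢ[ℝ] Plane := (ℝ ∙ (ρ⁻¹ • (y - x) - !₂[0, 1]))ᗮ.reflection
  have hR : R (ρ⁻¹ • (y - x)) = !₂[0, 1] := Submodule.reflection_sub hu
  have hset : Metric.closedBall x ρ ∩ Metric.closedBall y ρ =
      (fun z => z + -x) ⁻¹' ((fun z => ρ⁻¹ • z) ⁻¹' (R ⁻¹'
        (Metric.closedBall (0 : Plane) 1 ∩ Metric.closedBall !₂[0, 1] 1))) := by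
    ext z
    have h1 : ‖R (ρ⁻¹ • (z + -x))‖ = ρ⁻¹ * dist z x := by
      rw [R.norm_map, norm_smul, ← sub_eq_add_neg, ← dist_eq_norm,
        Real.norm_of_nonneg (by positivity)]
    have h2 : dist (R (ρ⁻¹ • (z + -x))) !₂[0, 1] = ρ⁻¹ * dist z y := by
      rw [← hR, R.dist_map, dist_eq_norm, ← smul_sub, norm_smul,
        Real.norm_of_nonneg (by positivity), dist_eq_norm]
      congr 2
      abel
    simp only [Set.mem_inter_iff, Metric.mem_closedBall, Set.mem_preimage, dist_zero_right, h1, h2,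
      inv_mul_le_iff₀ hρ, mul_one]
  have hm : MeasurableSet (Metric.closedBall (0 : Plane) 1 ∩ Metric.closedBall !₂[0, 1] 1) :=
    Metric.isClosed_closedBall.measurableSet.inter Metric.isClosed_closedBall.measurableSet
  rw [hset, measure_preimage_add_right, Measure.addHaar_preimage_smul _ (by positivity),
    R.measurePreserving.measure_preimage hm.nullMeasurableSet, volume_unit_lens,
    ← ENNReal.ofReal_mul (by positivity)]
  congr 1
  rw [finrank_euclideanSpace_fin, abs_of_pos (by positivity), inv_pow, inv_inv, mul_comm]

/-- The union of the two discs with radius `dist x y` around `x` and `y`. -/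
def twoDiscs (x y : Plane) : Set Plane :=
  Metric.closedBall x (dist x y) ∪ Metric.closedBall y (dist x y)

theorem measurableSet_twoDiscs (x y : Plane) : MeasurableSet (twoDiscs x y) :=
  Metric.isClosed_closedBall.measurableSet.union Metric.isClosed_closedBall.measurableSet

theorem volume_twoDiscs_ne_top (x y : Plane) : volume (twoDiscs x y) ≠ ∞ :=
  (measure_union_lt_top measure_closedBall_lt_top measure_closedBall_lt_top).ne

/-- Inclusion–exclusion: two discs of area `πρ²` minus a lens of area `πγρ²`. This is where `γ`
enters. -/
theorem volume_real_twoDiscs (x y : Plane) :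
    volume.real (twoDiscs x y) = Real.pi * (2 - gammaConst) * dist x y ^ 2 := by
  rcases eq_or_ne x y with rfl | hxy
  · simp [twoDiscs, measureReal_def]
  have h3 : √3 ^ 2 = 3 := Real.sq_sqrt (by norm_num)
  have hball : ∀ z : Plane, volume.real (Metric.closedBall z (dist x y)) =
      Real.pi * dist x y ^ 2 := by
    intro z
    rw [measureReal_def, EuclideanSpace.volume_closedBall_fin_two]
    simp [mul_comm, Real.pi_pos.le]
  have hlens : volume.real (Metric.closedBall x (dist x y) ∩ Metric.closedBall y (dist x y)) =
      (2 * Real.pi / 3 - √3 / 2) * dist x y ^ 2 := by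
    rw [measureReal_def, volume_lens hxy, ENNReal.toReal_ofReal]
    have : 0 ≤ 2 * Real.pi / 3 - √3 / 2 := by
      nlinarith [Real.pi_gt_three, Real.sqrt_nonneg 3]
    positivity
  have h := measureReal_union_add_inter (μ := volume) (s := Metric.closedBall x (dist x y))
    (t := Metric.closedBall y (dist x y)) Metric.isClosed_closedBall.measurableSet
    measure_closedBall_lt_top.ne measure_closedBall_lt_top.ne
  rw [hball, hball, hlens] at h
  have hpi := Real.pi_pos
  rw [twoDiscs, gammaConst]
  have : Real.pi * (2 - (2 / 3 - √3 / (2 * Real.pi))) = 2 * Real.pi - (2 * Real.pi / 3 - √3 / 2) := by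
    field_simp
  rw [this]
  linarith

theorem gammaConst_lt_one : gammaConst < 1 := by
  have : 0 ≤ √3 / (2 * Real.pi) := by positivity
  rw [gammaConst]
  linarith

theorem lintegral_comp_norm {g : ℝ → ℝ≥0∞} (hg : Measurable g) :
    ∫⁻ y : Plane, g ‖y‖ =
      ENNReal.ofReal (2 * Real.pi) * ∫⁻ ρ in Set.Ioi (0 : ℝ), ENNReal.ofReal ρ * g ρ := by
  have h1 : ∫⁻ y : Plane, g ‖y‖ = ∫⁻ z : ℂ, g ‖z‖ := by
    rw [← (Complex.orthonormalBasisOneI.repr.measurePreserving).lintegral_comp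
      (f := fun y => g ‖y‖) (hg.comp measurable_norm)]
    simp only [LinearIsometryEquiv.norm_map]
  rw [h1, ← Complex.lintegral_comp_polarCoord_symm]
  simp only [Complex.norm_polarCoord_symm, smul_eq_mul]
  rw [polarCoord_target, Measure.volume_eq_prod, ← Measure.prod_restrict,
    lintegral_prod _ (by fun_prop), mul_comm, ← lintegral_mul_const _ (by fun_prop)]
  refine setLIntegral_congr_fun measurableSet_Ioi fun ρ hρ => ?_
  simp only [lintegral_const, Measure.restrict_apply_univ, Real.volume_Ioo, abs_of_pos (Set.mem_Ioi.1 hρ)]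
  congr 2
  ring

end NNPairs

/-! ### Mutual nearest neighbours as an empty pair of discs -/

namespace NNPairs

namespace Config

theorem MNNR.unique {φ : Config} {x y z : Plane} (hy : φ.MNNR x y) (hz : φ.MNNR x z) : y = z := by
  by_contra hne
  have h1 := hy.1.2.2.2 z hz.1.2.1 hz.1.2.2.1.symm (Ne.symm hne)
  have h2 := hz.1.2.2.2 y hy.1.2.1 hy.1.2.2.1.symm hne
  exact lt_asymm h1 h2

/-- The partner `y` is itself paired, and deleting other atoms cannot bring a point closer. -/
theorem MNNR.nnDist_paired {φ : Config} {x y : Plane} (h : φ.MNNR x y) :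
    φ.paired.nnDist x = edist x y := by
  have hy : y ∈ φ.paired.atoms := ⟨h.1.2.1, x, h.1.1, h.2, h.1⟩
  refine le_antisymm (Metric.infEDist_le_edist_of_mem ⟨hy, h.1.2.2.1.symm⟩) ?_
  refine Metric.le_infEDist.2 fun z hz => ?_
  rcases eq_or_ne z y with rfl | hzy
  · exact le_rfl
  · rw [edist_dist, edist_dist]
    exact ENNReal.ofReal_le_ofReal (h.1.2.2.2 z hz.1.1 hz.2 hzy).le

/-- The two strict minimality conditions say that every third atom lies outside both closed discs.
Erasing `x` and then `y` puts the condition in the form required by two applications of the Mecke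
formula. -/
theorem mNNR_iff {φ : Config} {x y : Plane} (hx : x ∈ φ.atoms) :
    φ.MNNR x y ↔ y ∈ (φ.erase x).atoms ∧ (φ.erase x).erase y ∈ void (twoDiscs x y) := by
  simp only [MNNR, NNR, mem_void, atoms_erase, twoDiscs, Set.eq_empty_iff_forall_notMem,
    Set.mem_inter_iff, Set.mem_sdiff, Set.mem_singleton_iff, Set.mem_union, Metric.mem_closedBall,
    not_and, not_or, not_le, and_imp, hx, true_and, dist_comm y x]
  constructor
  · rintro ⟨⟨hy, hne, h1⟩, -, -, h2⟩
    refine ⟨⟨hy, hne.symm⟩, fun z hz hzx hzy => ⟨?_, ?_⟩⟩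
    · rw [dist_comm z x]
      exact h1 z hz hzx hzy
    · rw [dist_comm z y]
      exact h2 z hz hzy hzx
  · rintro ⟨⟨hy, hne⟩, h⟩
    refine ⟨⟨hy, Ne.symm hne, fun z hz hzx hzy => ?_⟩, hy, hne, fun z hz hzy hzx => ?_⟩
    · rw [dist_comm x z]
      exact (h z hz hzx hzy).1
    · rw [dist_comm y z]
      exact (h z hz hzx hzy).2

/-- By uniqueness of the partner at most one term survives, and it carries the nearest-neighbour
distance within the paired atoms. -/
theorem indicator_paired_eq_tsum (φ : Config) (g : ℝ≥0∞ → ℝ≥0∞) {x : Plane} (hx : x ∈ φ.atoms) :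
    φ.paired.atoms.indicator (fun x => g (φ.paired.nnDist x)) x =
      ∑' y : (φ.erase x).atoms, g (edist x (y : Plane)) *
        (void (twoDiscs x y)).indicator 1 ((φ.erase x).erase y) := by
  by_cases h : ∃ y, φ.MNNR x y
  · obtain ⟨y, hy⟩ := h
    have hy' := (mNNR_iff hx).1 hy
    have hxp : x ∈ φ.paired.atoms := ⟨hx, y, hy.1.2.1, hy⟩
    rw [Set.indicator_of_mem hxp, tsum_eq_single (⟨y, hy'.1⟩ : (φ.erase x).atoms)]
    · rw [Set.indicator_of_mem hy'.2, Pi.one_apply, mul_one, hy.nnDist_paired]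
    · intro z hz
      rw [Set.indicator_of_notMem, mul_zero]
      intro hzv
      exact hz (Subtype.ext (((mNNR_iff hx).2 ⟨z.2, hzv⟩).unique hy))
  · have hxp : x ∉ φ.paired.atoms := fun hp => h ⟨_, hp.2.choose_spec.2⟩
    rw [Set.indicator_of_notMem hxp]
    refine (ENNReal.tsum_eq_zero.2 fun z => ?_).symm
    rw [Set.indicator_of_notMem, mul_zero]
    exact fun hzv => h ⟨z, (mNNR_iff hx).2 ⟨z.2, hzv⟩⟩

theorem measurableSet_mem_void_twoDiscs {α : Type*} [MeasurableSpace α] {F : α → Config}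
    (hF : Measurable F) {u v : α → Plane} (hu : Measurable u) (hv : Measurable v) :
    MeasurableSet {a | F a ∈ void (twoDiscs (u a) (v a))} := by
  have hu' := hu.comp (measurable_fst : Measurable (Prod.fst : α × Plane → α))
  have hv' := hv.comp (measurable_fst : Measurable (Prod.fst : α × Plane → α))
  have h := measurableSet_forall_atom hF (p := fun a z => z ∉ twoDiscs (u a) (v a))
    ((measurableSet_le (measurable_snd.dist hu') (hu'.dist hv')).union
      (measurableSet_le (measurable_snd.dist hv') (hu'.dist hv'))).compl
  convert h using 1
  ext a
  simp only [mem_void, Set.eq_empty_iff_forall_notMem, Set.mem_inter_iff, not_and,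
    Set.mem_ofPred_eq]

end Config

open Config

variable {Ω : Type*} [MeasurableSpace Ω] {P : Measure Ω} {lam : ℝ≥0} {Φ : Ω → Config}

namespace IsPoissonProcess

/-- The expected sum of a function of the nearest neighbour distances over the paired atoms
in `A`. -/
theorem lintegral_tsum_paired [IsProbabilityMeasure P] (h : IsPoissonProcess P Φ lam)
    {A : Set Plane} (hA : MeasurableSet A) {g : ℝ≥0∞ → ℝ≥0∞} (hg : Measurable g) :
    ∫⁻ ω, ∑' x : (Φ ω).paired.atoms,
        A.indicator 1 (x : Plane) * g ((Φ ω).paired.nnDist x) ∂P =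
      lam ^ 2 * volume A * ∫⁻ y : Plane, g (ENNReal.ofReal ‖y‖) *
        ENNReal.ofReal (Real.exp (-(lam * Real.pi * (2 - gammaConst) * ‖y‖ ^ 2))) := by
  obtain ⟨H, hHdef⟩ : ∃ H : Plane → Plane × Config → ℝ≥0∞, ∀ x q, H x q =
    g (edist x q.1) * (void (twoDiscs x q.1)).indicator 1 q.2 := ⟨_, fun _ _ => rfl⟩
  have hH : Measurable fun q : Plane × Plane × Config => H q.1 q.2 := by
    simp only [hHdef]
    refine (hg.comp (measurable_fst.edist measurable_snd.fst)).mul ?_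
    exact measurable_one.indicator (measurableSet_mem_void_twoDiscs
      (F := fun q : Plane × Plane × Config => q.2.2) measurable_snd.snd measurable_fst
      measurable_snd.fst)
  let F : Plane × Config → ℝ≥0∞ := fun q =>
    A.indicator 1 q.1 * ∑' y : q.2.atoms, H q.1 (y, q.2.erase y)
  have hF : Measurable F := by
    refine ((measurable_one.indicator hA).comp measurable_fst).mul ?_
    refine measurable_tsum_atoms measurable_snd (f := fun (q : Plane × Config) (y : Plane) =>
      H q.1 (y, q.2.erase y)) ?_
    have he : Measurable fun r : (Plane × Config) × Plane => r.1.2.erase r.2 :=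
      measurable_erase (measurable_snd.comp measurable_fst) measurable_snd
    have ht : Measurable fun r : (Plane × Config) × Plane => (r.1.1, r.2, r.1.2.erase r.2) :=
      (measurable_fst.comp measurable_fst).prodMk (measurable_snd.prodMk he)
    exact hH.comp ht
  have e1 : ∀ ω, ∑' x : (Φ ω).paired.atoms,
      A.indicator 1 (x : Plane) * g ((Φ ω).paired.nnDist x) =
        ∑' x : (Φ ω).atoms, F (x, (Φ ω).erase x) := by
    intro ω
    rw [tsum_atoms_paired (Φ ω) (fun x => A.indicator 1 x * g ((Φ ω).paired.nnDist x))]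
    refine tsum_congr fun x => ?_
    simp only [F, hHdef]
    rw [← indicator_paired_eq_tsum (Φ ω) g x.2, Set.indicator_mul_right]
  -- Mecke formula for the partner `y`, with `x` fixed; the emptiness event then has probability
  -- `exp(-λ · area)`, and recentring at `x` removes the dependence on it.
  have e2 : ∀ x, ∫⁻ ω, F (x, Φ ω) ∂P = A.indicator 1 x * (lam * ∫⁻ y : Plane,
      g (ENNReal.ofReal ‖y‖) *
        ENNReal.ofReal (Real.exp (-(lam * Real.pi * (2 - gammaConst) * ‖y‖ ^ 2)))) := by
    intro x
    have hHx : Measurable (H x) := hH.comp measurable_prodMk_left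
    have hm : Measurable fun ω => ∑' y : (Φ ω).atoms, H x (y, (Φ ω).erase y) :=
      measurable_tsum_atoms h.measurable (f := fun ω y => H x (y, (Φ ω).erase y))
        (hHx.comp (measurable_snd.prodMk
          (measurable_erase (h.measurable.comp measurable_fst) measurable_snd)))
    simp only [F]
    rw [lintegral_const_mul _ hm, h.lintegral_tsum_erase hHx]
    congr 2
    rw [← lintegral_sub_right_eq_self (fun y : Plane => g (ENNReal.ofReal ‖y‖) *
      ENNReal.ofReal (Real.exp (-(lam * Real.pi * (2 - gammaConst) * ‖y‖ ^ 2)))) x]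
    refine lintegral_congr fun y => ?_
    have hv : MeasurableSet {ω | Φ ω ∈ void (twoDiscs x y)} :=
      h.measurable (measurableSet_void (measurableSet_twoDiscs x y))
    have hi : ∫⁻ ω, (void (twoDiscs x y)).indicator 1 (Φ ω) ∂P = voidProb lam (twoDiscs x y) := by
      rw [← h.prob_void (measurableSet_twoDiscs x y) (volume_twoDiscs_ne_top x y),
        ← lintegral_indicator_one hv]
      rfl
    simp only [hHdef]
    have hmi : Measurable fun ω => ((void (twoDiscs x y)).indicator 1 (Φ ω) : ℝ≥0∞) :=
      (measurable_one.indicator (measurableSet_void (measurableSet_twoDiscs x y))).comp h.measurable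
    rw [lintegral_const_mul _ hmi, hi, voidProb,
      volume_real_twoDiscs, edist_comm, edist_dist, dist_comm x y, dist_eq_norm,
      ← mul_assoc, ← mul_assoc]
  simp_rw [e1]
  -- Mecke formula for the paired atom `x` itself.
  rw [h.lintegral_tsum_erase hF]
  simp_rw [e2]
  rw [lintegral_mul_const _ (measurable_one.indicator hA), lintegral_indicator_one hA]
  ring

end IsPoissonProcess

/-! ### The Rayleigh distribution -/

theorem hasDerivAt_neg_exp_neg_mul_sq (c r : ℝ) :
    HasDerivAt (fun r => -Real.exp (-(c * r ^ 2))) (2 * c * r * Real.exp (-(c * r ^ 2))) r := by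
  have h := (((hasDerivAt_pow 2 r).const_mul c).fun_neg.exp).fun_neg
  have e : 2 * c * r * Real.exp (-(c * r ^ 2)) =
      -(Real.exp (-(c * r ^ 2)) * -(c * ((2 : ℕ) * r ^ (2 - 1)))) := by
    norm_num
    ring
  rw [e]
  exact h

theorem lintegral_Ioi_rayleigh {c : ℝ} (hc : 0 < c) :
    ∫⁻ r in Set.Ioi (0 : ℝ), ENNReal.ofReal (2 * c * r * Real.exp (-(c * r ^ 2))) = 1 := by
  have hlim : Filter.Tendsto (fun r : ℝ => -Real.exp (-(c * r ^ 2))) Filter.atTop (nhds 0) := by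
    have h : Filter.Tendsto (fun r : ℝ => c * r ^ 2) Filter.atTop Filter.atTop :=
      (Filter.tendsto_pow_atTop two_ne_zero).const_mul_atTop hc
    simpa using (Real.tendsto_exp_neg_atTop_nhds_zero.comp h).neg
  have hnn : ∀ r ∈ Set.Ioi (0 : ℝ), 0 ≤ 2 * c * r * Real.exp (-(c * r ^ 2)) := by
    intro r hr
    have : 0 < r := hr
    positivity
  rw [← ofReal_integral_eq_lintegral_ofReal
      (integrableOn_Ioi_deriv_of_nonneg' (fun r _ => hasDerivAt_neg_exp_neg_mul_sq c r) hnn hlim)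
      ((ae_restrict_mem measurableSet_Ioi).mono hnn),
    integral_Ioi_of_hasDerivAt_of_nonneg' (fun r _ => hasDerivAt_neg_exp_neg_mul_sq c r) hnn hlim]
  simp

theorem lintegral_Ioc_rayleigh {c r : ℝ} (hc : 0 < c) (hr : 0 ≤ r) :
    ∫⁻ s in Set.Ioc (0 : ℝ) r, ENNReal.ofReal (2 * c * s * Real.exp (-(c * s ^ 2))) =
      ENNReal.ofReal (1 - Real.exp (-(c * r ^ 2))) := by
  have hint : IntervalIntegrable (fun s => 2 * c * s * Real.exp (-(c * s ^ 2))) volume 0 r :=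
    Continuous.intervalIntegrable (by fun_prop) _ _
  rw [← ofReal_integral_eq_lintegral_ofReal hint.1, ← intervalIntegral.integral_of_le hr,
    intervalIntegral.integral_eq_sub_of_hasDerivAt
      (fun s _ => hasDerivAt_neg_exp_neg_mul_sq c s) hint]
  · congr 1
    simp
    ring
  · refine (ae_restrict_mem measurableSet_Ioc).mono fun s hs => ?_
    have : 0 < s := hs.1
    simp only [Pi.zero_apply]
    positivity

/-- For `σ = (2c)^(-1/2)` one has `σ⁻² = 2c`, giving the density `2cr exp(-cr²)`; the point `0` is
null. -/
theorem rayleighMeasure_apply {c : ℝ} (hc : 0 < c) {S : Set ℝ} (hS : MeasurableSet S) :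
    rayleighMeasure (√(2 * c))⁻¹ S =
      ∫⁻ r in Set.Ioi (0 : ℝ) ∩ S, ENNReal.ofReal (2 * c * r * Real.exp (-(c * r ^ 2))) := by
  have hσ : (√(2 * c))⁻¹ ^ 2 = (2 * c)⁻¹ := by
    rw [inv_pow, Real.sq_sqrt (by positivity)]
  rw [rayleighMeasure, withDensity_apply _ hS, ← Measure.restrict_restrict measurableSet_Ioi,
    ← lintegral_indicator measurableSet_Ioi]
  refine setLIntegral_congr_fun_ae hS ?_
  have h0 : ∀ᵐ r : ℝ, r ≠ 0 := by
    simp [ae_iff]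
  filter_upwards [h0] with r hr _
  rcases lt_or_gt_of_ne hr with h | h
  · simp [h.not_ge, h.le]
  · rw [if_pos h.le, Set.indicator_of_mem (Set.mem_Ioi.2 h), hσ]
    congr 2
    · field_simp
    · congr 1
      field_simp

theorem rayleighMeasure_univ {c : ℝ} (hc : 0 < c) :
    rayleighMeasure (√(2 * c))⁻¹ Set.univ = 1 := by
  rw [rayleighMeasure_apply hc MeasurableSet.univ, Set.inter_univ, lintegral_Ioi_rayleigh hc]

theorem rayleighMeasure_Iic {c r : ℝ} (hc : 0 < c) (hr : 0 ≤ r) :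
    rayleighMeasure (√(2 * c))⁻¹ (Set.Iic r) =
      ENNReal.ofReal (1 - Real.exp (-(c * r ^ 2))) := by
  rw [rayleighMeasure_apply hc measurableSet_Iic, Set.Ioi_inter_Iic, lintegral_Ioc_rayleigh hc hr]

/-- Polar coordinates give the weight `2πρ exp(-cρ²)`, which is `π/c` times the Rayleigh density. -/
theorem lintegral_plane_eq_rayleigh {c : ℝ} (hc : 0 < c) {S : Set ℝ≥0∞} (hS : MeasurableSet S) :
    ∫⁻ y : Plane, S.indicator 1 (ENNReal.ofReal ‖y‖) *
        ENNReal.ofReal (Real.exp (-(c * ‖y‖ ^ 2))) =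
      ENNReal.ofReal (Real.pi / c) * (rayleighMeasure (√(2 * c))⁻¹).map ENNReal.ofReal S := by
  have hi : Measurable fun r : ℝ => (S.indicator 1 (ENNReal.ofReal r) : ℝ≥0∞) :=
    (measurable_one.indicator hS).comp ENNReal.measurable_ofReal
  have hS' : MeasurableSet (ENNReal.ofReal ⁻¹' S) := ENNReal.measurable_ofReal hS
  rw [lintegral_comp_norm (g := fun r => S.indicator 1 (ENNReal.ofReal r) *
    ENNReal.ofReal (Real.exp (-(c * r ^ 2)))) (hi.mul (by fun_prop)),
    Measure.map_apply ENNReal.measurable_ofReal hS, rayleighMeasure_apply hc hS',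
    Set.inter_comm, ← Measure.restrict_restrict hS', ← lintegral_indicator hS',
    ← lintegral_const_mul _ (by fun_prop), ← lintegral_const_mul _ (Measurable.indicator
      (by fun_prop) hS')]
  refine setLIntegral_congr_fun measurableSet_Ioi fun r hr => ?_
  have hr0 : 0 < r := hr
  by_cases h : ENNReal.ofReal r ∈ S
  · have h' : r ∈ ENNReal.ofReal ⁻¹' S := h
    simp only [Set.indicator_of_mem h, Set.indicator_of_mem h', Pi.one_apply, one_mul]
    rw [← ENNReal.ofReal_mul (by positivity), ← ENNReal.ofReal_mul (by positivity),
      ← ENNReal.ofReal_mul (by positivity)]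
    congr 1
    field_simp
  · have h' : r ∉ ENNReal.ofReal ⁻¹' S := h
    simp [Set.indicator_of_notMem h, Set.indicator_of_notMem h']

/-! ### Nearest-neighbour law under the Palm measure -/

namespace IsPoissonProcess

theorem lintegral_tsum_paired_indicator [IsProbabilityMeasure P] (h : IsPoissonProcess P Φ lam)
    {c : ℝ} (hc : 0 < c) (hcl : c = lam * Real.pi * (2 - gammaConst))
    {S : Set ℝ≥0∞} (hS : MeasurableSet S) :
    ∫⁻ ω, ∑' x : (Φ ω).paired.atoms,
        unitSquare.indicator 1 (x : Plane) * S.indicator 1 ((Φ ω).paired.nnDist x) ∂P =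
      lam ^ 2 * ENNReal.ofReal (Real.pi / c) *
        (rayleighMeasure (√(2 * c))⁻¹).map ENNReal.ofReal S := by
  rw [h.lintegral_tsum_paired measurableSet_unitSquare (measurable_one.indicator hS),
    volume_unitSquare, mul_one, ← hcl, lintegral_plane_eq_rayleigh hc hS, mul_assoc]

/-- Take `S` to be everything in the preceding formula. The value is also the normalising constant
for the Palm law; it equals `λ/(2 - γ)`. -/
theorem intensity_paired [IsProbabilityMeasure P] (h : IsPoissonProcess P Φ lam)
    {c : ℝ} (hc : 0 < c) (hcl : c = lam * Real.pi * (2 - gammaConst)) :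
    intensity P (fun ω => (Φ ω).paired) = lam ^ 2 * ENNReal.ofReal (Real.pi / c) := by
  have e := h.lintegral_tsum_paired_indicator hc hcl MeasurableSet.univ
  rw [Measure.map_apply ENNReal.measurable_ofReal MeasurableSet.univ, Set.preimage_univ,
    rayleighMeasure_univ hc, mul_one] at e
  rw [NNPairs.intensity_eq, ← e]
  simp

/-- Under the Palm measure of the process of pairs, the nearest neighbour distance has a Rayleigh
distribution. -/
theorem map_nnDist_palm [IsProbabilityMeasure P] (h : IsPoissonProcess P Φ lam)
    {c : ℝ} (hc : 0 < c) (hcl : c = lam * Real.pi * (2 - gammaConst)) {Q : Measure Config}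
    (hQ : IsPalm P (fun ω => (Φ ω).paired) Q) :
    Q.map (nnDist 0) = (rayleighMeasure (√(2 * c))⁻¹).map ENNReal.ofReal := by
  ext S hS
  rw [Measure.map_apply (measurable_nnDist 0) hS]
  have e := hQ.intensity_mul (measurable_nnDist 0 hS)
  refine (ENNReal.mul_right_inj hQ.intensity_pos.ne' hQ.intensity_lt_top.ne).1 (e.trans ?_)
  rw [h.intensity_paired hc hcl, ← h.lintegral_tsum_paired_indicator hc hcl hS]
  classical
  refine lintegral_congr fun ω => tsum_congr fun x => ?_
  congr 1
  simp only [Set.indicator_apply, Set.mem_preimage, nnDist_translate, sub_neg_eq_add, zero_add,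
    Pi.one_apply]

end IsPoissonProcess

theorem map_nnDist_palmAt (Q : Measure Config) (x : Plane) :
    (palmAt Q x).map (nnDist x) = Q.map (nnDist 0) := by
  have hx : Measurable (Config.translate x) := measurable_translate measurable_id measurable_const
  rw [palmAt, Measure.map_map (measurable_nnDist x) hx]
  congr 1
  ext φ
  simp [nnDist_translate]

end NNPairs

open NNPairs
theorem theorem3 {Ω : Type*} [MeasurableSpace Ω] (P : Measure Ω) [IsProbabilityMeasure P]
    (lam : ℝ≥0) (hlam : 0 < lam) (Φ : Ω → Config) (hΦ : IsPoissonProcess P Φ lam) :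
    -- the Palm measures of `Φ` and of the process of pairs exist and are unique
    (∃! P₀ : Measure Config, IsPalm P Φ P₀) ∧
    (∃! Q : Measure Config, IsPalm P (fun ω => (Φ ω).paired) Q) ∧
    ∀ P₀ Q : Measure Config, IsPalm P Φ P₀ → IsPalm P (fun ω => (Φ ω).paired) Q →
      -- identification of the Palm measure of the process of pairs
      (Q = (cond P₀ {φ : Config | (0 : Plane) ∈ φ.paired.atoms}).map Config.paired) ∧
      -- the nearest neighbour function, as seen from an atom at any point
      (∀ (x : Plane) (r : ℝ), 0 ≤ r →
        (palmAt Q x).real {ψ : Config | ψ.nnDist x ≤ ENNReal.ofReal r} =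
          1 - Real.exp (-(lam * Real.pi * r ^ 2 * (2 - gammaConst)))) ∧
      -- the nearest neighbour distance is Rayleigh distributed
      (∀ x : Plane, (palmAt Q x).map (Config.nnDist x) =
        (rayleighMeasure (√(2 * lam * Real.pi * (2 - gammaConst)))⁻¹).map ENNReal.ofReal) := by
  have hg : 0 < 2 - gammaConst := by linarith [gammaConst_lt_one]
  have hlam' : (0 : ℝ) < lam := hlam
  obtain ⟨c, hcl⟩ : ∃ c : ℝ, c = lam * Real.pi * (2 - gammaConst) := ⟨_, rfl⟩
  have hc : 0 < c := by
    rw [hcl]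
    have := Real.pi_pos
    positivity
  have hint := hΦ.intensity_eq
  have hst := hΦ.isStationary
  refine ⟨existsUnique_isPalm hst ?_ ?_, existsUnique_isPalm hst.paired ?_ ?_,
    fun P₀ Q hP₀ hQ => ⟨hP₀.eq_map_cond hQ, fun x r hr => ?_, fun x => ?_⟩⟩
  · rw [hint]
    exact_mod_cast hlam
  · rw [hint]
    exact ENNReal.coe_lt_top
  · rw [hΦ.intensity_paired hc hcl]
    refine ENNReal.mul_pos (pow_ne_zero _ (by exact_mod_cast hlam.ne')) ?_
    exact (ENNReal.ofReal_pos.2 (div_pos Real.pi_pos hc)).ne'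
  · refine intensity_paired_le.trans_lt ?_
    rw [hint]
    exact ENNReal.coe_lt_top
  · have e : palmAt Q x {ψ : Config | ψ.nnDist x ≤ ENNReal.ofReal r} =
        ENNReal.ofReal (1 - Real.exp (-(c * r ^ 2))) := by
      calc palmAt Q x {ψ : Config | ψ.nnDist x ≤ ENNReal.ofReal r}
          = (palmAt Q x).map (Config.nnDist x) (Set.Iic (ENNReal.ofReal r)) :=
            (Measure.map_apply (Config.measurable_nnDist x) measurableSet_Iic).symm
        _ = ENNReal.ofReal (1 - Real.exp (-(c * r ^ 2))) := by
            rw [map_nnDist_palmAt, hΦ.map_nnDist_palm hc hcl hQ,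
              Measure.map_apply ENNReal.measurable_ofReal measurableSet_Iic,
              ← rayleighMeasure_Iic hc hr]
            congr 1
            ext s
            -- Truncation at zero does not change the event, because `r` is nonnegative.
            simp [ENNReal.ofReal_le_ofReal_iff hr]
    rw [measureReal_def, e, ENNReal.toReal_ofReal, hcl]
    · congr 3
      ring
    · rw [sub_nonneg, Real.exp_le_one_iff]
      have : 0 ≤ c * r ^ 2 := by positivity
      linarith
  · rw [map_nnDist_palmAt, hΦ.map_nnDist_palm hc hcl hQ, hcl]
    congr 4
    ring
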